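/- Let $\gamma\subset\mathbb R^d$ be a locally finite set, and let $\phi:\mathbb R_+\to\mathbb R_+$ be measurable and bounded, with $\phi(t)\ge\phi_*>0$ for $t\in[0,r_*]$ and $\phi(t)=0$ for $t>r_*$, where $r_*>0$. Let $\chi$ be a finite symmetric Borel measure on $\mathbb R$ with $\int_{\mathbb R}\exp(\varkappa|t|^u)\,\chi(dt)<\infty$ for some $u>2$ and $\varkappa>0$, and let $\beta>0$. For a bounded Borel set $\Lambda\subset\mathbb R^d$ put $\gamma_\Lambda=\gamma\cap\Lambda$, and for $\bar\sigma\in\mathbb R^\gamma$ let $$-E_\Lambda(\sigma_\Lambda|\bar\sigma_{\Lambda^c})=\sum_{\{x,y\}\subset\gamma_\Lambda}\phi(|x-y|)\sigma_x\sigma_y+\sum_{x\in\gamma_\Lambda,\,y\in\gamma\setminus\Lambda}\phi(|x-y|)\sigma_x\bar\sigma_y ,$$ the first sum being over unordered pairs of distinct points. Let $\Pi_\Lambda(\cdot|\bar\sigma)$ be the probability measure on $\mathbb R^\gamma$ under which $\sigma=\bar\sigma$ outside $\Lambda$ and $\sigma_\Lambda$ has law proportional to $\exp(-\beta E_\Lambda(\sigma_\Lambda|\bar\sigma_{\Lambda^c}))\prod_{x\in\gamma_\Lambda}\chi(d\sigma_x)$.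 A probability measure $\mu$ on $\mathbb R^\gamma$ is a Gibbs measure, $\mu\in\mathcal G(\beta|\gamma)$, if $\mu(A)=\int\Pi_\Lambda(A|\sigma)\,\mu(d\sigma)$ for all measurable $A$ and all bounded Borel $\Lambda$. For $b\in\mathbb R$, a limiting Gibbs measure with boundary condition $b$ is an element of $\mathcal G(\beta|\gamma)$ that is the limit of $\Pi_{\Lambda_n}(\cdot|\bar\sigma\equiv b)$ for some increasing sequence $(\Lambda_n)$ of bounded Borel sets such that every bounded Borel set is contained in some $\Lambda_n$; the convergence is that of the probabilities of all events which depend on the spins in a bounded Borel set only. Let $a>0$ be such that $$\chi([a\sqrt2,+\infty))\ \ge\ \chi([0,a]).$$ Let $\mu^{+a}$ be any limiting Gibbs measure with boundary condition $a$. Let $\nu^+$ be the Gibbs measure of the Ising model (single-spin measure $(\delta_{-1}+\delta_{+1})/2$, same $\phi$ and $\gamma$) at inverse temperature $a^2\beta$ which is the limiting one with boundary condition $+1$, i.e. the maximal Ising Gibbs measure. Let $x\in\gamma$. Then $\sigma_x$ is $\nu^+$-integrable, and $$\int_{\mathbb R^\gamma}\sigma_x\,\mu^{+a}(d\sigma)\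 \ge\ a\int_{\mathbb R^\gamma}\sigma_x\,\nu^{+}(d\sigma)$$ whenever $\sigma_x$ is $\mu^{+a}$-integrable. The latter is the case if $\gamma\in A_1$, that is, if for all $\alpha,\theta>0$ $$\sum_{\{x,y\}\subset\gamma,\ 0<|x-y|\le r_*}\big[e^{-\alpha|x|}+e^{-\alpha|y|}\big]\,[n_\gamma(x)n_\gamma(y)]^\theta<\infty\quad\text{and}\quad\sum_{x\in\gamma}e^{-\alpha|x|}<\infty ,$$ where $n_\gamma(x)$ is the number of points $y\in\gamma$ with $0<|x-y|\le r_*$. -/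

import Mathlib

open MeasureTheory Filter Topology Set
open scoped NNReal ENNReal

namespace AmorphousFerromagnet

noncomputable section

/-- The space `Γ` of locally finite configurations in `ℝ^d`. -/
def configurations (d : ℕ) : Set (Set (EuclideanSpace ℝ (Fin d))) :=
  {γ | ∀ K : Set (EuclideanSpace ℝ (Fin d)), IsCompact K → (γ ∩ K).Finite}

/-- Bounded Borel subsets of `ℝ^d`. -/
def IsBoundedBorel {d : ℕ} (Λ : Set (EuclideanSpace ℝ (Fin d))) : Prop :=
  Bornology.IsBounded Λ ∧ MeasurableSet Λ

/-- The Gilbert graph: distinct points of `γ` are adjacent if their distance is at most `r`. -/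
def gilbertGraph {d : ℕ} (γ : Set (EuclideanSpace ℝ (Fin d))) (r : ℝ) : SimpleGraph γ where
  Adj x y := x ≠ y ∧ dist x y ≤ r
  symm := ⟨fun x y h => ⟨h.1.symm, by rw [dist_comm]; exact h.2⟩⟩
  loopless := ⟨fun _ h => h.1 rfl⟩

/-- The number `n_γ(x)` of neighbours of `x`. -/
def numNeighbors {d : ℕ} (γ : Set (EuclideanSpace ℝ (Fin d))) (r : ℝ) (x : γ) : ℕ :=
  ((gilbertGraph γ r).neighborSet x).ncard

/-- The weight `w_α(x) = exp(-α|x|)`. -/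
def weight {d : ℕ} (α : ℝ) (x : EuclideanSpace ℝ (Fin d)) : ℝ :=
  Real.exp (-α * ‖x‖)

/-- `a_γ(α, θ)`, the sum over all edges `{x, y}` of `[w_α(x) + w_α(y)] [n_γ(x) n_γ(y)]^θ`.
It is written as a sum over ordered pairs of neighbours: each edge occurs once with the weight
of each of its end points. -/
def edgeSum {d : ℕ} (γ : Set (EuclideanSpace ℝ (Fin d))) (r α θ : ℝ) : ℝ≥0∞ :=
  ∑' (x : γ) (y : (gilbertGraph γ r).neighborSet x),
    ENNReal.ofReal (weight α (x : EuclideanSpace ℝ (Fin d)) *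
      ((numNeighbors γ r x : ℝ) * (numNeighbors γ r y.1 : ℝ)) ^ θ)

/-- `b_γ(α)`, the sum over all vertices `x` of `w_α(x)`. -/
def vertexSum {d : ℕ} (γ : Set (EuclideanSpace ℝ (Fin d))) (α : ℝ) : ℝ≥0∞ :=
  ∑' x : γ, ENNReal.ofReal (weight α (x : EuclideanSpace ℝ (Fin d)))

/-- The set `A₁` of configurations whose Gilbert graph has weighted summable degrees. -/
def sparseConfigurations (d : ℕ) (r : ℝ) : Set (Set (EuclideanSpace ℝ (Fin d))) :=
  {γ | γ ∈ configurations d ∧ (∀ α > 0, ∀ θ > 0, edgeSum γ r α θ < ∞) ∧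
    ∀ α > 0, vertexSum γ α < ∞}

open Classical in
/-- The finite set `γ_Λ = γ ∩ Λ` of vertices (`∅` if that set is infinite, which does not happen
for `γ` locally finite and `Λ` bounded). -/
def verticesIn {d : ℕ} (γ Λ : Set (EuclideanSpace ℝ (Fin d))) : Finset γ :=
  if h : {x : γ | (x : EuclideanSpace ℝ (Fin d)) ∈ Λ}.Finite then h.toFinset else ∅

open Classical in
/-- `σ_Λ × σ̄_{Λᶜ}`: the spins `s` on the finite vertex set `V`, the spins `σ'` off `V`. -/
def glue {ι : Type*} (V : Finset ι) (s : V → ℝ) (σ' : ι → ℝ) : ι → ℝ :=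
  fun x => if h : x ∈ V then s ⟨x, h⟩ else σ' x

open Classical in
/-- The relative energy `E_Λ(σ_Λ | σ_{Λᶜ})` on the finite vertex set `V = γ_Λ`. The first sum
runs over unordered pairs of distinct points of `V` (ordered pairs, halved); in the second one
only finitely many terms differ from zero if `γ` is locally finite and `φ` has finite range. -/
def energy {d : ℕ} {γ : Set (EuclideanSpace ℝ (Fin d))} (φ : ℝ≥0 → ℝ≥0)
    (V : Finset γ) (σ : γ → ℝ) : ℝ :=
  -((1 / 2 : ℝ) * ∑ p ∈ V.offDiag, (φ (nndist p.1 p.2) : ℝ) * (σ p.1 * σ p.2) +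
    ∑ x ∈ V, ∑' y : {y : γ // y ∉ V}, (φ (nndist x y.1) : ℝ) * (σ x * σ y.1))

/-- The unnormalized weight `exp(-β E_Λ(σ_Λ | σ̄_{Λᶜ})) χ_Λ(dσ_Λ)`. -/
def boltzmann {d : ℕ} {γ : Set (EuclideanSpace ℝ (Fin d))} (χ : Measure ℝ) (φ : ℝ≥0 → ℝ≥0)
    (β : ℝ) (V : Finset γ) (σ' : γ → ℝ) : Measure (V → ℝ) :=
  (Measure.pi fun _ : V => χ).withDensity
    fun s => ENNReal.ofReal (Real.exp (-β * energy φ V (glue V s σ')))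

/-- The Gibbs specification `Π_Λ(· | σ̄)`. The `σ`-algebra on `γ → ℝ` is the product one, which is
the Borel one because a locally finite `γ` is countable. -/
def gibbsKernel {d : ℕ} (γ : Set (EuclideanSpace ℝ (Fin d))) (χ : Measure ℝ) (φ : ℝ≥0 → ℝ≥0)
    (β : ℝ) (Λ : Set (EuclideanSpace ℝ (Fin d))) (σ' : γ → ℝ) : Measure (γ → ℝ) :=
  (boltzmann χ φ β (verticesIn γ Λ) σ' univ)⁻¹ •
    (boltzmann χ φ β (verticesIn γ Λ) σ').map fun s => glue (verticesIn γ Λ) s σ'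

/-- The set `𝒢(β|γ)` of Gibbs measures: the probability measures that satisfy the
Dobrushin-Lanford-Ruelle equation. -/
def gibbsMeasures {d : ℕ} (γ : Set (EuclideanSpace ℝ (Fin d))) (χ : Measure ℝ) (φ : ℝ≥0 → ℝ≥0)
    (β : ℝ) : Set (Measure (γ → ℝ)) :=
  {μ | IsProbabilityMeasure μ ∧ ∀ Λ : Set (EuclideanSpace ℝ (Fin d)), IsBoundedBorel Λ →
    ∀ A : Set (γ → ℝ), MeasurableSet A → μ A = ∫⁻ σ, gibbsKernel γ χ φ β Λ σ A ∂μ}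

/-- Local sets: `A = {σ | σ_Λ ∈ A₀}` with `Λ` bounded Borel and `A₀` measurable. -/
def IsLocalSet {d : ℕ} {γ : Set (EuclideanSpace ℝ (Fin d))} (A : Set (γ → ℝ)) : Prop :=
  ∃ Λ : Set (EuclideanSpace ℝ (Fin d)), IsBoundedBorel Λ ∧
    ∃ A₀ : Set ({x : γ // (x : EuclideanSpace ℝ (Fin d)) ∈ Λ} → ℝ), MeasurableSet A₀ ∧
      A = (fun (σ : γ → ℝ) (x : {x : γ // (x : EuclideanSpace ℝ (Fin d)) ∈ Λ}) => σ x.1) ⁻¹' A₀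

/-- The topology of local set convergence: the weakest one for which `μ ↦ μ(A)` is continuous for
all local sets `A`. -/
abbrev localTopology {d : ℕ} (γ : Set (EuclideanSpace ℝ (Fin d))) :
    TopologicalSpace (Measure (γ → ℝ)) :=
  ⨅ (A : Set (γ → ℝ)) (_ : IsLocalSet A),
    TopologicalSpace.induced (fun μ : Measure (γ → ℝ) => μ A) inferInstance

theorem tendsto_localTopology_iff {d : ℕ} {γ : Set (EuclideanSpace ℝ (Fin d))} {T : Type*}
    {l : Filter T} {P : T → Measure (γ → ℝ)} {μ : Measure (γ → ℝ)} :
    Tendsto P l (@nhds _ (localTopology γ) μ) ↔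
      ∀ A : Set (γ → ℝ), IsLocalSet A → Tendsto (fun n => P n A) l (𝓝 (μ A)) := by
  unfold localTopology
  simp only [nhds_iInf, tendsto_iInf, nhds_induced, tendsto_comap_iff]
  rfl

/-- Cofinal sequences of bounded Borel sets. -/
def IsCofinalSeq {d : ℕ} (Λ : ℕ → Set (EuclideanSpace ℝ (Fin d))) : Prop :=
  (∀ n, IsBoundedBorel (Λ n)) ∧ (∀ n, Λ n ⊆ Λ (n + 1)) ∧
    ∀ Δ : Set (EuclideanSpace ℝ (Fin d)), IsBoundedBorel Δ → ∃ n, Δ ⊆ Λ n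

/-- `μ` is a limiting Gibbs measure for the constant boundary condition `σ̄ = b`: a Gibbs measure
which is the limit, in the topology of local set convergence, of `Π_{Λ_n}(· | b)` along some
cofinal sequence. -/
def IsLimitingState {d : ℕ} (γ : Set (EuclideanSpace ℝ (Fin d))) (χ : Measure ℝ)
    (φ : ℝ≥0 → ℝ≥0) (β b : ℝ) (μ : Measure (γ → ℝ)) : Prop :=
  μ ∈ gibbsMeasures γ χ φ β ∧ ∃ Λ : ℕ → Set (EuclideanSpace ℝ (Fin d)), IsCofinalSeq Λ ∧
    Tendsto (fun n => gibbsKernel γ χ φ β (Λ n) fun _ => b) atTop (@nhds _ (localTopology γ) μ)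

/-- The Ising single-spin measure `(δ_{-1} + δ_{+1}) / 2`. -/
def isingMeasure : Measure ℝ :=
  (2⁻¹ : ℝ≥0∞) • (Measure.dirac (-1) + Measure.dirac 1)

/-- `ν` is the Gibbs measure `ν⁺` of the Ising model: the limiting Gibbs measure for the boundary
condition `+1`. -/
def IsIsingPlusState {d : ℕ} (γ : Set (EuclideanSpace ℝ (Fin d))) (φ : ℝ≥0 → ℝ≥0) (β : ℝ)
    (ν : Measure (γ → ℝ)) : Prop :=
  IsLimitingState γ isingMeasure φ β 1 ν

end

end AmorphousFerromagnet

namespace AmorphousFerromagnet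

/-- The polynomial `∑ J x y s_x s_y + ∑ h x s_x`. -/
def pairForm {V : Type*} [Fintype V] (J : V → V → ℝ) (h : V → ℝ) (s : V → ℝ) : ℝ :=
  ∑ x, ∑ y, J x y * (s x * s y) + ∑ x, h x * s x

section PairForm

variable {V : Type*} [Fintype V]

theorem abs_pairForm_le (J : V → V → ℝ) (h : V → ℝ) (s : V → ℝ) :
    |pairForm J h s| ≤ (∑ x, ∑ y, |J x y| + ∑ x, |h x|) * ∑ x, (1 + s x ^ 2) := by
  have hQ : ∀ x, 1 + s x ^ 2 ≤ ∑ x, (1 + s x ^ 2) := fun x =>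
    Finset.single_le_sum (f := fun x => 1 + s x ^ 2) (fun i _ => by positivity) (Finset.mem_univ x)
  have h2 : ∀ x y, |s x * s y| ≤ ∑ x, (1 + s x ^ 2) := fun x y => by
    have := hQ x
    have := hQ y
    rw [abs_le]
    constructor <;> nlinarith [sq_nonneg (s x + s y), sq_nonneg (s x - s y)]
  have h1 : ∀ x, |s x| ≤ ∑ x, (1 + s x ^ 2) := fun x => by
    have := hQ x
    rw [abs_le]
    constructor <;> nlinarith [sq_nonneg (s x + 1), sq_nonneg (s x - 1)]
  unfold pairForm
  rw [add_mul, Finset.sum_mul, Finset.sum_mul]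
  refine (abs_add_le _ _).trans (add_le_add ?_ ?_)
  · refine (Finset.abs_sum_le_sum_abs _ _).trans (Finset.sum_le_sum fun x _ => ?_)
    rw [Finset.sum_mul]
    refine (Finset.abs_sum_le_sum_abs _ _).trans (Finset.sum_le_sum fun y _ => ?_)
    rw [abs_mul]
    exact mul_le_mul_of_nonneg_left (h2 x y) (abs_nonneg _)
  · refine (Finset.abs_sum_le_sum_abs _ _).trans (Finset.sum_le_sum fun x _ => ?_)
    rw [abs_mul]
    exact mul_le_mul_of_nonneg_left (h1 x) (abs_nonneg _)

theorem measurable_pairForm (J : V → V → ℝ) (h : V → ℝ) : Measurable (pairForm J h) := by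
  unfold pairForm
  fun_prop

theorem pairForm_add_pairForm (J : V → V → ℝ) (h h' s t : V → ℝ) :
    pairForm J h s + pairForm J h' t =
      pairForm (fun x y => J x y / 2) (fun x => (h x + h' x) / 2) (fun x => s x + t x) +
      pairForm (fun x y => J x y / 2) (fun x => (h x - h' x) / 2) (fun x => s x - t x) := by
  simp only [pairForm]
  rw [add_add_add_comm, add_add_add_comm (∑ x, ∑ y, J x y / 2 * _)]
  simp only [← Finset.sum_add_distrib]
  refine Finset.sum_congr rfl fun x _ => ?_
  congr 1
  · exact Finset.sum_congr rfl fun y _ => by ring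
  · ring

end PairForm

section Ginibre

variable {V Ω : Type*} [Fintype V] {p q G : Ω → ℝ}

theorem abs_le_exp_one_add_sq (t : ℝ) : |t| ≤ Real.exp (1 + t ^ 2) := by
  have h1 := Real.add_one_le_exp (1 + t ^ 2)
  have : |t| ≤ 1 + t ^ 2 := by nlinarith [sq_nonneg (|t| - 1), sq_abs t, abs_nonneg t]
  linarith

theorem abs_pow_mul_pow_le (p q : ℝ) (m n : ℕ) :
    |p ^ m * q ^ n| ≤ Real.exp ((m + n) * (1 + p ^ 2 + q ^ 2)) := by
  have hp : |p| ≤ Real.exp (1 + p ^ 2 + q ^ 2) :=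
    (abs_le_exp_one_add_sq p).trans (Real.exp_le_exp.2 (by nlinarith [sq_nonneg q]))
  have hq : |q| ≤ Real.exp (1 + p ^ 2 + q ^ 2) :=
    (abs_le_exp_one_add_sq q).trans (Real.exp_le_exp.2 (by nlinarith [sq_nonneg p]))
  rw [abs_mul, abs_pow, abs_pow, add_mul, Real.exp_add, Real.exp_nat_mul, Real.exp_nat_mul]
  gcongr

/-- The cone spanned by the monomials in the variables `p (ω x)` and `q (ω x)`. -/
def monomialCone (V : Type*) {Ω : Type*} (p q : Ω → ℝ) : Subsemiring ((V → Ω) → ℝ) :=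
  Subsemiring.closure ((range fun (x : V) (ω : V → Ω) => p (ω x)) ∪
    (range fun (x : V) (ω : V → Ω) => q (ω x)) ∪ {F | ∃ c : ℝ, 0 ≤ c ∧ F = fun _ => c})

theorem pairForm_mem_monomialCone {J : V → V → ℝ} (hJ : ∀ x y, 0 ≤ J x y) {h : V → ℝ}
    (hh : ∀ x, 0 ≤ h x) {g : Ω → ℝ}
    (hg : ∀ x, (fun ω : V → Ω => g (ω x)) ∈ monomialCone V p q) :
    (fun ω : V → Ω => pairForm J h fun x => g (ω x)) ∈ monomialCone V p q := by
  have hc : ∀ c : ℝ, 0 ≤ c → (fun _ : V → Ω => c) ∈ monomialCone V p q := fun c hc =>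
    Subsemiring.subset_closure (Or.inr ⟨c, hc, rfl⟩)
  have : (fun ω : V → Ω => pairForm J h fun x => g (ω x)) =
      ∑ x, ∑ y, (fun _ => J x y) * ((fun ω => g (ω x)) * fun ω => g (ω y)) +
        ∑ x, (fun _ => h x) * fun ω => g (ω x) := by
    ext ω
    simp [pairForm, Finset.sum_apply]
  rw [this]
  exact add_mem (sum_mem fun x _ => sum_mem fun y _ =>
    mul_mem (hc _ (hJ x y)) (mul_mem (hg x) (hg y)))
    (sum_mem fun x _ => mul_mem (hc _ (hh x)) (hg x))

theorem exists_monomial_of_mem_closure [DecidableEq V] {F : (V → Ω) → ℝ}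
    (hF : F ∈ Submonoid.closure ((range fun (x : V) (ω : V → Ω) => p (ω x)) ∪
      (range fun (x : V) (ω : V → Ω) => q (ω x)) ∪ {F | ∃ c : ℝ, 0 ≤ c ∧ F = fun _ => c})) :
    ∃ c : ℝ, 0 ≤ c ∧ ∃ m n : V → ℕ,
      F = fun ω => c * ∏ x, (p (ω x) ^ m x * q (ω x) ^ n x) := by
  induction hF using Submonoid.closure_induction with
  | mem F hF =>
    rcases hF with (⟨x, rfl⟩ | ⟨x, rfl⟩) | ⟨c, hc, rfl⟩
    · refine ⟨1, zero_le_one, Pi.single x 1, 0, ?_⟩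
      ext ω
      simp [Pi.single_apply, pow_ite]
    · refine ⟨1, zero_le_one, 0, Pi.single x 1, ?_⟩
      ext ω
      simp [Pi.single_apply, pow_ite]
    · exact ⟨c, hc, 0, 0, by simp⟩
  | one => exact ⟨1, zero_le_one, 0, 0, by ext; simp⟩
  | mul F F' _ _ hF hF' =>
    obtain ⟨c, hc, m, n, rfl⟩ := hF
    obtain ⟨c', hc', m', n', rfl⟩ := hF'
    refine ⟨c * c', mul_nonneg hc hc', m + m', n + n', ?_⟩
    ext ω
    simp only [Pi.mul_apply, Pi.add_apply, pow_add]
    rw [mul_mul_mul_comm, ← Finset.prod_mul_distrib]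
    congr 1
    exact Finset.prod_congr rfl fun x _ => by ring

variable [MeasurableSpace Ω] {ρ : Measure Ω}

theorem integrable_site (hp : Measurable p) (hq : Measurable q) (hG : Measurable G)
    (hint : ∀ c : ℝ, Integrable (fun w => Real.exp (c * (1 + p w ^ 2 + q w ^ 2))) ρ)
    {C : ℝ} (hGC : ∀ w, |G w| ≤ Real.exp (C * (1 + p w ^ 2 + q w ^ 2))) (m n : ℕ) :
    Integrable (fun w => G w * (p w ^ m * q w ^ n)) ρ := by
  refine (hint (C + (m + n))).mono' (by fun_prop) (ae_of_all _ fun w => ?_)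
  rw [Real.norm_eq_abs, abs_mul, add_mul, Real.exp_add]
  exact mul_le_mul (hGC w) (abs_pow_mul_pow_le _ _ _ _) (abs_nonneg _) (Real.exp_nonneg _)

variable [SigmaFinite ρ]

theorem integral_monomialCone_nonneg (hp : Measurable p) (hq : Measurable q) (hG : Measurable G)
    (hint : ∀ c : ℝ, Integrable (fun w => Real.exp (c * (1 + p w ^ 2 + q w ^ 2))) ρ)
    {C : ℝ} (hGC : ∀ w, |G w| ≤ Real.exp (C * (1 + p w ^ 2 + q w ^ 2)))
    (hpos : ∀ m n : ℕ, 0 ≤ ∫ w, p w ^ m * q w ^ n ∂ρ)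
    (hGpos : ∀ m n : ℕ, 0 ≤ ∫ w, G w * (p w ^ m * q w ^ n) ∂ρ) (x₀ : V)
    {F : (V → Ω) → ℝ} (hF : F ∈ monomialCone V p q) :
    Integrable (fun ω => G (ω x₀) * F ω) (Measure.pi fun _ : V => ρ) ∧
      0 ≤ ∫ ω, G (ω x₀) * F ω ∂(Measure.pi fun _ : V => ρ) := by
  classical
  unfold monomialCone at hF
  rw [← SetLike.mem_coe, Subsemiring.coe_closure_eq, SetLike.mem_coe] at hF
  induction hF using AddSubmonoid.closure_induction with
  | mem F hF =>
    obtain ⟨c, hc, m, n, rfl⟩ := exists_monomial_of_mem_closure hF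
    have key : (fun ω : V → Ω => G (ω x₀) * (c * ∏ x, (p (ω x) ^ m x * q (ω x) ^ n x))) =
        fun ω => c * ∏ x, (if x = x₀ then G (ω x) else 1) * (p (ω x) ^ m x * q (ω x) ^ n x) := by
      ext ω
      rw [Finset.prod_mul_distrib (f := fun x => if x = x₀ then G (ω x) else 1),
        Finset.prod_ite_eq']
      simp only [Finset.mem_univ, if_true]
      ring
    have hsite : ∀ x : V, Integrable
        (fun w => (if x = x₀ then G w else 1) * (p w ^ m x * q w ^ n x)) ρ := fun x => by
      split_ifs
      · exact integrable_site hp hq hG hint hGC _ _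
      · exact integrable_site (G := fun _ => 1) (C := 0) hp hq measurable_const hint
          (fun w => by simp) _ _
    rw [key]
    refine ⟨(Integrable.fintype_prod hsite).const_mul c, ?_⟩
    rw [integral_const_mul, integral_fintype_prod_eq_prod
      (f := fun x w => (if x = x₀ then G w else 1) * (p w ^ m x * q w ^ n x))]
    refine mul_nonneg hc (Finset.prod_nonneg fun x _ => ?_)
    split_ifs
    · exact hGpos _ _
    · simpa using hpos _ _
  | zero => simp
  | add F F' _ _ hF hF' =>
    have : (fun ω => G (ω x₀) * (F + F') ω) =
        fun ω => G (ω x₀) * F ω + G (ω x₀) * F' ω := by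
      ext ω
      simp [mul_add]
    rw [this]
    exact ⟨hF.1.add hF'.1, by rw [integral_add hF.1 hF'.1]; exact add_nonneg hF.2 hF'.2⟩

theorem integrable_exp_sum
    (hint : ∀ c : ℝ, Integrable (fun w => Real.exp (c * (1 + p w ^ 2 + q w ^ 2))) ρ) (c : ℝ) :
    Integrable (fun ω : V → Ω => Real.exp (c * ∑ x, (1 + p (ω x) ^ 2 + q (ω x) ^ 2)))
      (Measure.pi fun _ : V => ρ) := by
  simp_rw [Finset.mul_sum, Real.exp_sum]
  exact Integrable.fintype_prod (f := fun _ w => Real.exp (c * (1 + p w ^ 2 + q w ^ 2)))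
    fun _ => hint c

/-- Ginibre's inequality: if all site moments are non-negative, the expectation of `G` with
respect to a ferromagnetic Boltzmann weight in the variables `p`, `q` is non-negative. -/
theorem ginibre_nonneg (hp : Measurable p) (hq : Measurable q) (hG : Measurable G)
    (hint : ∀ c : ℝ, Integrable (fun w => Real.exp (c * (1 + p w ^ 2 + q w ^ 2))) ρ)
    {C : ℝ} (hGC : ∀ w, |G w| ≤ Real.exp (C * (1 + p w ^ 2 + q w ^ 2)))
    (hpos : ∀ m n : ℕ, 0 ≤ ∫ w, p w ^ m * q w ^ n ∂ρ)
    (hGpos : ∀ m n : ℕ, 0 ≤ ∫ w, G w * (p w ^ m * q w ^ n) ∂ρ)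
    {J : V → V → ℝ} (hJ : ∀ x y, 0 ≤ J x y) {h k : V → ℝ} (hh : ∀ x, 0 ≤ h x)
    (hk : ∀ x, 0 ≤ k x) (x₀ : V) :
    0 ≤ ∫ ω, G (ω x₀) * Real.exp (pairForm J h (fun x => p (ω x)) +
      pairForm J k fun x => q (ω x)) ∂(Measure.pi fun _ : V => ρ) := by
  set H : (V → Ω) → ℝ := fun ω => pairForm J h (fun x => p (ω x)) + pairForm J k fun x => q (ω x)
    with hH
  have hHmem : H ∈ monomialCone V p q :=
    add_mem (pairForm_mem_monomialCone hJ hh fun x =>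
      Subsemiring.subset_closure (Or.inl (Or.inl ⟨x, rfl⟩)))
      (pairForm_mem_monomialCone hJ hk fun x =>
        Subsemiring.subset_closure (Or.inl (Or.inr ⟨x, rfl⟩)))
  have hHm : Measurable H :=
    ((measurable_pairForm J h).comp (by fun_prop)).add ((measurable_pairForm J k).comp (by fun_prop))
  have hGm : Measurable fun ω : V → Ω => G (ω x₀) := by fun_prop
  obtain ⟨D, hD⟩ : ∃ D : ℝ, ∀ ω, |H ω| ≤ D * ∑ x, (1 + p (ω x) ^ 2 + q (ω x) ^ 2) := by
    refine ⟨(∑ x, ∑ y, |J x y| + ∑ x, |h x|) + (∑ x, ∑ y, |J x y| + ∑ x, |k x|), fun ω => ?_⟩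
    refine (abs_add_le _ _).trans ?_
    rw [add_mul]
    refine add_le_add ((abs_pairForm_le _ _ _).trans ?_) ((abs_pairForm_le _ _ _).trans ?_)
    · exact mul_le_mul_of_nonneg_left (Finset.sum_le_sum fun x _ =>
        le_add_of_nonneg_right (sq_nonneg _)) (by positivity)
    · exact mul_le_mul_of_nonneg_left (Finset.sum_le_sum fun x _ => by
        nlinarith [sq_nonneg (p (ω x))]) (by positivity)
  have hdom : Integrable (fun ω => |G (ω x₀)| * Real.exp |H ω|) (Measure.pi fun _ : V => ρ) := by
    refine (integrable_exp_sum hint (|C| + D)).mono' (by fun_prop) (ae_of_all _ fun ω => ?_)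
    rw [Real.norm_eq_abs, abs_mul, abs_abs, Real.abs_exp, add_mul, Real.exp_add]
    refine mul_le_mul ((hGC _).trans (Real.exp_le_exp.2 ?_)) (Real.exp_le_exp.2 (hD ω))
      (Real.exp_nonneg _) (Real.exp_nonneg _)
    refine mul_le_mul (le_abs_self C) ?_ (by positivity) (abs_nonneg C)
    exact Finset.single_le_sum (f := fun x => 1 + p (ω x) ^ 2 + q (ω x) ^ 2)
      (fun i _ => by positivity) (Finset.mem_univ x₀)
  have hexp : ∀ t : ℝ, HasSum (fun n : ℕ => t ^ n / (n.factorial : ℝ)) (Real.exp t) := fun t => by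
    rw [Real.exp_eq_exp_ℝ]
    exact NormedSpace.expSeries_div_hasSum_exp t
  have hsum := hasSum_integral_of_dominated_convergence
    (μ := Measure.pi fun _ : V => ρ)
    (F := fun (n : ℕ) ω => G (ω x₀) * (H ω ^ n / (n.factorial : ℝ)))
    (f := fun ω => G (ω x₀) * Real.exp (H ω))
    (fun n ω => |G (ω x₀)| * (|H ω| ^ n / (n.factorial : ℝ)))
    (fun n => (hGm.mul ((hHm.pow_const n).div_const _)).aestronglyMeasurable)
    (fun n => ae_of_all _ fun ω => by
      rw [Real.norm_eq_abs, abs_mul, abs_div, abs_pow, Nat.abs_cast])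
    (ae_of_all _ fun ω => ((hexp _).mul_left _).summable)
    (by
      refine hdom.congr (ae_of_all _ fun ω => ?_)
      exact ((hexp _).mul_left _).tsum_eq.symm)
    (ae_of_all _ fun ω => (hexp _).mul_left _)
  refine hsum.nonneg fun n => ?_
  have := (integral_monomialCone_nonneg hp hq hG hint hGC hpos hGpos x₀ (pow_mem hHmem n)).2
  have e : (fun ω => G (ω x₀) * (H ω ^ n / (n.factorial : ℝ))) =
      fun ω => (n.factorial : ℝ)⁻¹ * (G (ω x₀) * (H ^ n) ω) := by
    ext ω
    simp only [Pi.pow_apply]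
    ring
  simp only [e]
  rw [integral_const_mul]
  positivity

end Ginibre

section Wells

/-- Truncation of the spin at height `M`. -/
def clip (M s : ℝ) : ℝ := max (-M) (min M s)

theorem continuous_clip (M : ℝ) : Continuous (clip M) := by
  unfold clip
  fun_prop

theorem clip_eq_self {M s : ℝ} (h : |s| ≤ M) : clip M s = s := by
  rw [abs_le] at h
  rw [clip, min_eq_right h.2, max_eq_right h.1]

theorem clip_neg {M : ℝ} (hM : 0 ≤ M) (s : ℝ) : clip M (-s) = -clip M s := by
  unfold clip
  rcases le_total M s with h | h <;> rcases le_total (-M) s with h' | h'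
  · rw [min_eq_right (by linarith), max_eq_left (by linarith), min_eq_left h,
      max_eq_right (by linarith)]
  · rw [min_eq_right (by linarith), max_eq_left (by linarith), min_eq_left h,
      max_eq_right (by linarith)]
  · rw [min_eq_right (by linarith), max_eq_right (by linarith), min_eq_right h,
      max_eq_right (by linarith)]
  · rw [min_eq_left (by linarith), max_eq_right (by linarith), min_eq_right h,
      max_eq_left (by linarith), neg_neg]

theorem abs_clip_le {M : ℝ} (hM : 0 ≤ M) (s : ℝ) : |clip M s| ≤ M := by
  rw [abs_le, clip]
  exact ⟨le_max_left _ _, max_le (by linarith) (min_le_left _ _)⟩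

theorem clip_of_nonneg {M s : ℝ} (hM : 0 ≤ M) (hs : 0 ≤ s) : clip M s = min M s :=
  max_eq_right (by linarith [le_min hM hs])

theorem abs_clip_le_abs {M : ℝ} (hM : 0 ≤ M) (s : ℝ) : |clip M s| ≤ |s| := by
  rcases le_total |s| M with h | h
  · rw [clip_eq_self h]
  · exact (abs_clip_le hM s).trans h

theorem exists_wells_constant_of_le {a : ℝ} (ha : 0 < a) {m N : ℕ} (hmN : m ≤ N)
    (heven : Even (m + N)) :
    ∃ B : ℝ, 0 ≤ B ∧
      (∀ c, a * √2 ≤ c → B ≤ (c + a) ^ m * (c - a) ^ N + (c - a) ^ m * (c + a) ^ N) ∧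
      ∀ s, |s| ≤ a → -B ≤ (s + a) ^ m * (s - a) ^ N + (s - a) ^ m * (s + a) ^ N := by
  have h2 : (1 : ℝ) ≤ √2 := by
    rw [Real.one_le_sqrt]
    norm_num
  have hca : ∀ c, a * √2 ≤ c → a ≤ c := fun c hc => by nlinarith
  rcases Nat.even_or_odd m with hm | hm
  · have hN : Even N := (Nat.even_add.1 heven).1 hm
    refine ⟨0, le_rfl, fun c _ => ?_, fun s _ => ?_⟩
    · exact add_nonneg (mul_nonneg (hm.pow_nonneg _) (hN.pow_nonneg _))
        (mul_nonneg (hm.pow_nonneg _) (hN.pow_nonneg _))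
    · rw [neg_zero]
      exact add_nonneg (mul_nonneg (hm.pow_nonneg _) (hN.pow_nonneg _))
        (mul_nonneg (hm.pow_nonneg _) (hN.pow_nonneg _))
  obtain ⟨j, rfl⟩ := Nat.exists_eq_add_of_le hmN
  have hj : Even j := by
    rw [← add_assoc, Nat.even_add] at heven
    exact heven.1 ⟨m, rfl⟩
  have hfac : ∀ s : ℝ, (s + a) ^ m * (s - a) ^ (m + j) + (s - a) ^ m * (s + a) ^ (m + j) =
      (s ^ 2 - a ^ 2) ^ m * ((s + a) ^ j + (s - a) ^ j) := fun s => by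
    rw [show s ^ 2 - a ^ 2 = (s + a) * (s - a) by ring, mul_pow]
    ring
  obtain ⟨D, hD, hD₁, hD₂⟩ : ∃ D : ℝ, 0 ≤ D ∧
      (∀ v w : ℝ, 0 ≤ v → 0 ≤ w → v + w = 2 * a → v ^ j + w ^ j ≤ D) ∧
      ∀ v w : ℝ, 2 * a ≤ v → 0 ≤ w → D ≤ v ^ j + w ^ j := by
    rcases eq_or_ne j 0 with rfl | hj0
    · exact ⟨2, by norm_num, fun _ _ _ _ _ => by norm_num, fun _ _ _ _ => by norm_num⟩
    · refine ⟨(2 * a) ^ j, by positivity, fun v w hv hw hvw => ?_, fun v w hv hw => ?_⟩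
      · rw [← hvw]
        exact pow_add_pow_le hv hw hj0
      · exact (pow_le_pow_left₀ (by positivity) hv j).trans
          (le_add_of_nonneg_right (pow_nonneg hw j))
  refine ⟨(a ^ 2) ^ m * D, by positivity, fun c hc => ?_, fun s hs => ?_⟩
  · rw [hfac]
    have h1 := hca c hc
    have : (a * √2) ^ 2 ≤ c ^ 2 := pow_le_pow_left₀ (by positivity) hc 2
    rw [mul_pow, Real.sq_sqrt (by norm_num)] at this
    exact mul_le_mul (pow_le_pow_left₀ (by positivity) (by linarith) m)
      (hD₂ _ _ (by linarith) (by linarith)) hD (pow_nonneg (by nlinarith) m)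
  · rw [hfac]
    have hs' := abs_le.1 hs
    have h1 : s ^ 2 ≤ a ^ 2 := sq_le_sq' hs'.1 hs'.2
    have h3 := hD₁ (s + a) (a - s) (by linarith) (by linarith) (by ring)
    rw [show (a - s) ^ j = (s - a) ^ j by rw [← hj.neg_pow, neg_sub]] at h3
    rw [show s ^ 2 - a ^ 2 = -(a ^ 2 - s ^ 2) by ring, hm.neg_pow, neg_mul, neg_le_neg_iff]
    exact mul_le_mul (pow_le_pow_left₀ (by linarith) (by nlinarith) m) h3
      (add_nonneg (hj.pow_nonneg _) (hj.pow_nonneg _)) (by positivity)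

theorem exists_wells_constant {a : ℝ} (ha : 0 < a) {m N : ℕ} (heven : Even (m + N)) :
    ∃ B : ℝ, 0 ≤ B ∧
      (∀ c, a * √2 ≤ c → B ≤ (c + a) ^ m * (c - a) ^ N + (c - a) ^ m * (c + a) ^ N) ∧
      ∀ s, |s| ≤ a → -B ≤ (s + a) ^ m * (s - a) ^ N + (s - a) ^ m * (s + a) ^ N := by
  rcases le_total m N with h | h
  · exact exists_wells_constant_of_le ha h heven
  · obtain ⟨B, hB, h1, h2⟩ := exists_wells_constant_of_le ha h (by rwa [add_comm])
    refine ⟨B, hB, fun c hc => (h1 c hc).trans_eq ?_, fun s hs => (h2 s hs).trans_eq ?_⟩ <;> ring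

/-- The integrand of a site moment, for the value `t` of the Ising spin. -/
def siteMoment (M a : ℝ) (e m n : ℕ) (s : ℝ) : ℝ :=
  (clip M s - a) ^ e * ((s + a) ^ m * (s - a) ^ n)

theorem siteMoment_neg {M : ℝ} (hM : 0 ≤ M) (a : ℝ) (e m n : ℕ) (s : ℝ) :
    siteMoment M a e m n (-s) = (-1) ^ (e + m + n) * siteMoment M (-a) e m n s := by
  unfold siteMoment
  rw [clip_neg hM, show -clip M s - a = (-1) * (clip M s - -a) by ring,
    show -s + a = (-1) * (s + -a) by ring, show -s - a = (-1) * (s - -a) by ring,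
    mul_pow, mul_pow, mul_pow]
  ring

theorem siteMoment_add_ge {a M : ℝ} (ha : 0 < a) (hM : a * √2 ≤ M) {e m n : ℕ} {B : ℝ}
    (h1 : ∀ c, a * √2 ≤ c →
      B ≤ (c + a) ^ m * (c - a) ^ (e + n) + (c - a) ^ m * (c + a) ^ (e + n))
    (h2 : ∀ s, |s| ≤ a →
      -B ≤ (s + a) ^ m * (s - a) ^ (e + n) + (s - a) ^ m * (s + a) ^ (e + n))
    {s : ℝ} (hs : 0 ≤ s) :
    B * ((if a * √2 ≤ s then 1 else 0) - if s ≤ a then 1 else 0) ≤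
      siteMoment M a e m n s + siteMoment M (-a) e m n s := by
  have hsq : (1 : ℝ) < √2 := by
    rw [Real.lt_sqrt (by norm_num)]
    norm_num
  have har : a < a * √2 := by nlinarith
  have hM0 : 0 ≤ M := by linarith
  have hc := clip_of_nonneg hM0 hs
  simp only [siteMoment, sub_neg_eq_add, ← sub_eq_add_neg]
  rcases le_or_gt s a with hsa | hsa
  · rw [if_neg (by linarith), if_pos hsa, hc, min_eq_right (by linarith)]
    have := h2 s (by rwa [abs_of_nonneg hs])
    rw [pow_add, pow_add] at this
    linarith
  · rw [if_neg (by linarith : ¬ s ≤ a)]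
    have hca : a ≤ clip M s := by
      rw [hc]
      exact le_min (by linarith) hsa.le
    split_ifs with hr
    · have hcr : a * √2 ≤ clip M s := by
        rw [hc]
        exact le_min hM hr
      have hcs : clip M s ≤ s := by
        rw [hc]
        exact min_le_right _ _
      rw [sub_zero, mul_one]
      refine (h1 _ hcr).trans ?_
      rw [pow_add, pow_add]
      have k1 : 0 ≤ clip M s - a := by linarith
      have k2 : 0 ≤ clip M s + a := by linarith
      have e1 : (clip M s + a) ^ m * ((clip M s - a) ^ e * (clip M s - a) ^ n) ≤
          (clip M s - a) ^ e * ((s + a) ^ m * (s - a) ^ n) := by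
        rw [mul_left_comm]
        gcongr
      have e2 : (clip M s - a) ^ m * ((clip M s + a) ^ e * (clip M s + a) ^ n) ≤
          (clip M s + a) ^ e * ((s - a) ^ m * (s + a) ^ n) := by
        rw [mul_left_comm]
        gcongr
      exact add_le_add e1 e2
    · have k1 : 0 ≤ clip M s - a := by linarith
      have k2 : 0 ≤ clip M s + a := by linarith
      have k3 : 0 ≤ s - a := by linarith
      have k4 : 0 ≤ s + a := by linarith
      simp only [sub_zero, mul_zero]
      positivity

instance : IsProbabilityMeasure isingMeasure := by
  refine ⟨?_⟩
  simp [isingMeasure, ENNReal.inv_two_add_inv_two]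

theorem integral_isingMeasure (g : ℝ → ℝ) :
    ∫ t, g t ∂isingMeasure = (g (-1) + g 1) / 2 := by
  have hd : ∀ c : ℝ, Integrable g (Measure.dirac c) := fun c =>
    integrable_dirac (by simp [enorm_eq_nnnorm])
  rw [isingMeasure, integral_smul_measure, integral_add_measure (hd _) (hd _), integral_dirac,
    integral_dirac]
  simp
  ring

theorem integrable_isingMeasure (g : ℝ → ℝ) : Integrable g isingMeasure :=
  (Integrable.add_measure (integrable_dirac (by simp [enorm_eq_nnnorm]))
    (integrable_dirac (by simp [enorm_eq_nnnorm]))).smul_measure (by simp)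

theorem integral_prod_isingMeasure {χ : Measure ℝ} [IsFiniteMeasure χ] {F : ℝ × ℝ → ℝ}
    (hF : Integrable F (χ.prod isingMeasure)) :
    ∫ z, F z ∂(χ.prod isingMeasure) = (∫ s, F (s, -1) ∂χ + ∫ s, F (s, 1) ∂χ) / 2 := by
  rw [integral_prod_symm _ hF, integral_isingMeasure]

theorem integral_comp_neg_of_map_neg {χ : Measure ℝ} (hsymm : χ.map (fun t => -t) = χ)
    (g : ℝ → ℝ) : ∫ s, g (-s) ∂χ = ∫ s, g s ∂χ := by
  have : MeasurePreserving (MeasurableEquiv.neg ℝ) χ χ := ⟨measurable_neg, hsymm⟩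
  exact this.integral_comp' g

/-- Wells' moment inequality for one site. -/
theorem wells_site {χ : Measure ℝ} [IsFiniteMeasure χ] (hsymm : χ.map (fun t => -t) = χ)
    {a M : ℝ} (ha : 0 < a) (hM : a * √2 ≤ M) (hWells : χ (Icc 0 a) ≤ χ (Ici (a * √2)))
    {e m n : ℕ} (h1 : Integrable (siteMoment M a e m n) χ)
    (h1' : Integrable (siteMoment M (-a) e m n) χ) :
    0 ≤ ∫ s, siteMoment M (-a) e m n s ∂χ + ∫ s, siteMoment M a e m n s ∂χ := by
  have hM0 : 0 ≤ M := le_trans (by positivity) hM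
  have hneg := integral_comp_neg_of_map_neg hsymm (siteMoment M a e m n)
  simp only [siteMoment_neg hM0] at hneg
  rw [integral_const_mul] at hneg
  rcases Nat.even_or_odd (e + m + n) with hN | hN
  swap
  · rw [hN.neg_one_pow] at hneg
    linarith
  obtain ⟨B, hB, hB₁, hB₂⟩ := exists_wells_constant ha (m := m) (N := e + n)
    (by convert hN using 1; ring)
  have hsub : ∀ s, B * ((if a * √2 ≤ |s| then 1 else 0) - if |s| ≤ a then 1 else 0) ≤
      siteMoment M (-a) e m n s + siteMoment M a e m n s := fun s => by
    rcases le_total 0 s with hs | hs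
    · rw [abs_of_nonneg hs, add_comm (siteMoment M (-a) e m n s)]
      exact siteMoment_add_ge ha hM hB₁ hB₂ hs
    · rw [abs_of_nonpos hs]
      have h := siteMoment_add_ge ha hM hB₁ hB₂ (neg_nonneg.2 hs)
      rw [siteMoment_neg hM0, siteMoment_neg hM0, hN.neg_one_pow, neg_neg, one_mul, one_mul] at h
      exact h
  have hm1 : MeasurableSet {s : ℝ | a * √2 ≤ |s|} := measurableSet_le measurable_const (by fun_prop)
  have hm2 : MeasurableSet {s : ℝ | |s| ≤ a} := measurableSet_le (by fun_prop) measurable_const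
  have hind : ∀ s : ℝ, B * ((if a * √2 ≤ |s| then 1 else 0) - if |s| ≤ a then 1 else 0) =
      B * (({s : ℝ | a * √2 ≤ |s|}.indicator 1 s : ℝ) - {s : ℝ | |s| ≤ a}.indicator 1 s) :=
    fun s => by simp [indicator_apply]
  have hi1 : Integrable ({s : ℝ | a * √2 ≤ |s|}.indicator (1 : ℝ → ℝ)) χ :=
    (integrable_const 1).indicator hm1
  have hi2 : Integrable ({s : ℝ | |s| ≤ a}.indicator (1 : ℝ → ℝ)) χ :=
    (integrable_const 1).indicator hm2
  rw [← integral_add h1' h1]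
  refine le_trans ?_ (integral_mono (((hi1.sub hi2).const_mul B)) (h1'.add h1) fun s => by
    have := hsub s
    rw [hind s] at this
    exact this)
  simp only [Pi.sub_apply]
  rw [integral_const_mul, integral_sub hi1 hi2, integral_indicator_one hm1,
    integral_indicator_one hm2]
  refine mul_nonneg hB (sub_nonneg.2 ?_)
  have hrefl : ∀ S : Set ℝ, MeasurableSet S → χ.real (Neg.neg ⁻¹' S) = χ.real S := fun S hS => by
    rw [measureReal_def, measureReal_def, ← Measure.map_apply measurable_neg hS]
    exact congrArg (fun ν : Measure ℝ => (ν S).toReal) hsymm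
  have hW : χ.real (Icc 0 a) ≤ χ.real (Ici (a * √2)) :=
    ENNReal.toReal_mono (measure_ne_top _ _) hWells
  have hle : χ.real {s : ℝ | |s| ≤ a} ≤ χ.real (Icc 0 a) + χ.real (Icc 0 a) := by
    conv_rhs => rw [← hrefl _ measurableSet_Icc, hrefl _ measurableSet_Icc,
      ← hrefl _ measurableSet_Icc]
    refine (measureReal_mono ?_).trans (measureReal_union_le (Icc 0 a) (Neg.neg ⁻¹' Icc 0 a))
      |>.trans_eq (by rw [hrefl _ measurableSet_Icc])
    intro s hs
    have := abs_le.1 (show |s| ≤ a from hs)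
    rcases le_total 0 s with h | h
    · exact Or.inl ⟨h, this.2⟩
    · exact Or.inr ⟨by linarith, by linarith⟩
  have hge : χ.real (Ici (a * √2)) + χ.real (Ici (a * √2)) ≤ χ.real {s : ℝ | a * √2 ≤ |s|} := by
    have hpos : 0 < a * √2 := by positivity
    rw [← hrefl (Ici (a * √2)) measurableSet_Ici]
    nth_rewrite 2 [hrefl _ measurableSet_Ici]
    rw [← measureReal_union _ measurableSet_Ici]
    · refine measureReal_mono ?_
      rintro s (hs | hs)
      · exact (show a * √2 ≤ -s from hs).trans (neg_le_abs s)
      · exact (show a * √2 ≤ s from hs).trans (le_abs_self s)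
    · rw [Set.disjoint_left]
      intro s hs hs'
      have h1 : a * √2 ≤ -s := hs
      have h2 : a * √2 ≤ s := hs'
      linarith
  linarith

end Wells

section FiniteVolume

variable {V : Type*} [Fintype V] {χ : Measure ℝ}

theorem abs_clip_sub_le {M : ℝ} (hM : 0 ≤ M) (s b : ℝ) :
    |clip M s - b| ≤ Real.exp (2 * (1 + (s + b) ^ 2 + (s - b) ^ 2)) := by
  have h1 : |clip M s - b| ≤ |s| + |b| :=
    (abs_sub _ _).trans (add_le_add_left (abs_clip_le_abs hM _) _)
  have h2 := Real.add_one_le_exp (2 * (1 + (s + b) ^ 2 + (s - b) ^ 2))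
  have h3 : |s| ≤ 1 + s ^ 2 := by nlinarith [sq_abs s, sq_nonneg (|s| - 1)]
  have h4 : |b| ≤ 1 + b ^ 2 := by nlinarith [sq_abs b, sq_nonneg (|b| - 1)]
  nlinarith

theorem integrable_exp_duplicate (hexp : ∀ c : ℝ, Integrable (fun t => Real.exp (c * t ^ 2)) χ)
    (a c : ℝ) : Integrable (fun w : ℝ × ℝ =>
      Real.exp (c * (1 + (w.1 + a * w.2) ^ 2 + (w.1 - a * w.2) ^ 2))) (χ.prod isingMeasure) := by
  have h1 := (((hexp (2 * c)).const_mul (Real.exp c)).mul_prod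
    (integrable_isingMeasure fun t => Real.exp (2 * c * a ^ 2 * t ^ 2)))
  refine h1.congr (ae_of_all _ fun w => ?_)
  simp only [← Real.exp_add]
  congr 1
  ring

theorem integrable_siteMoment (hexp : ∀ c : ℝ, Integrable (fun t => Real.exp (c * t ^ 2)) χ)
    {M : ℝ} (hM : 0 ≤ M) (b : ℝ) (e m n : ℕ) : Integrable (siteMoment M b e m n) χ := by
  have hcm : Measurable (clip M) := (continuous_clip M).measurable
  have hi : ∀ c : ℝ, Integrable (fun s => Real.exp (c * (1 + (s + b) ^ 2 + (s - b) ^ 2))) χ :=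
    fun c => by
    refine ((hexp (2 * c)).const_mul (Real.exp (c + 2 * c * b ^ 2))).congr
      (ae_of_all _ fun w => ?_)
    simp only [← Real.exp_add]
    congr 1
    ring
  refine integrable_site (ρ := χ) (p := fun s => s + b) (q := fun s => s - b)
    (G := fun s => (clip M s - b) ^ e) (by fun_prop) (by fun_prop) (by fun_prop) hi
    (C := e * 2) (fun w => ?_) m n
  rw [abs_pow, mul_assoc, Real.exp_nat_mul]
  exact pow_le_pow_left₀ (abs_nonneg _) (abs_clip_sub_le hM w b) e

variable [IsFiniteMeasure χ]

theorem integrable_mul_exp_pairForm (hexp : ∀ c : ℝ, Integrable (fun t => Real.exp (c * t ^ 2)) χ)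
    (J : V → V → ℝ) (h : V → ℝ) {g : (V → ℝ) → ℝ} (hg : Measurable g) {c : ℝ}
    (hgc : ∀ s, |g s| ≤ Real.exp (c * ∑ x, (1 + s x ^ 2))) :
    Integrable (fun s => g s * Real.exp (pairForm J h s)) (Measure.pi fun _ : V => χ) := by
  have hint : ∀ c : ℝ, Integrable (fun t => Real.exp (c * (1 + t ^ 2))) χ := fun c => by
    simp_rw [mul_add, Real.exp_add]
    exact (hexp c).const_mul _
  have hm := measurable_pairForm J h
  set D := ∑ x, ∑ y, |J x y| + ∑ x, |h x|
  have hdom : Integrable (fun s : V → ℝ => Real.exp ((c + D) * ∑ x, (1 + s x ^ 2)))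
      (Measure.pi fun _ : V => χ) := by
    simp_rw [Finset.mul_sum, Real.exp_sum]
    exact Integrable.fintype_prod (f := fun _ t => Real.exp ((c + D) * (1 + t ^ 2)))
      fun _ => hint _
  refine hdom.mono' (by fun_prop) (ae_of_all _ fun s => ?_)
  rw [Real.norm_eq_abs, abs_mul, Real.abs_exp, add_mul, Real.exp_add]
  exact mul_le_mul (hgc s) (Real.exp_le_exp.2 ((le_abs_self _).trans (abs_pairForm_le J h s)))
    (Real.exp_nonneg _) (Real.exp_nonneg _)

theorem one_add_sq_le_sum (s : V → ℝ) (x : V) : 1 + s x ^ 2 ≤ ∑ x, (1 + s x ^ 2) :=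
  Finset.single_le_sum (f := fun x => 1 + s x ^ 2) (fun _ _ => by positivity) (Finset.mem_univ x)

theorem integrable_exp_pairForm (hexp : ∀ c : ℝ, Integrable (fun t => Real.exp (c * t ^ 2)) χ)
    (J : V → V → ℝ) (h : V → ℝ) :
    Integrable (fun s => Real.exp (pairForm J h s)) (Measure.pi fun _ : V => χ) := by
  simpa using integrable_mul_exp_pairForm hexp J h (g := fun _ => 1) measurable_const (c := 0)
    (fun s => by simp)

theorem integrable_sq_mul_exp_pairForm
    (hexp : ∀ c : ℝ, Integrable (fun t => Real.exp (c * t ^ 2)) χ)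
    (J : V → V → ℝ) (h : V → ℝ) (x : V) :
    Integrable (fun s => s x ^ 2 * Real.exp (pairForm J h s)) (Measure.pi fun _ : V => χ) := by
  refine integrable_mul_exp_pairForm hexp J h (c := 1) (by fun_prop) fun s => ?_
  rw [one_mul, abs_of_nonneg (sq_nonneg _)]
  have := Real.add_one_le_exp (∑ x, (1 + s x ^ 2))
  linarith [one_add_sq_le_sum s x]

theorem integrable_mul_exp_pairForm_of_bound
    (hexp : ∀ c : ℝ, Integrable (fun t => Real.exp (c * t ^ 2)) χ)
    (J : V → V → ℝ) (h : V → ℝ) {g : (V → ℝ) → ℝ} (hg : Measurable g) {K : ℝ}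
    (hgK : ∀ s, |g s| ≤ K) :
    Integrable (fun s => g s * Real.exp (pairForm J h s)) (Measure.pi fun _ : V => χ) :=
  (integrable_exp_pairForm hexp J h).bdd_mul (c := K) hg.aestronglyMeasurable
    (ae_of_all _ fun s => hgK s)

theorem pairForm_const_mul (J : V → V → ℝ) (h : V → ℝ) (a : ℝ) (s : V → ℝ) :
    pairForm J h (fun x => a * s x) =
      pairForm (fun x y => a ^ 2 * J x y) (fun x => a * h x) s := by
  unfold pairForm
  congr 1
  · exact Finset.sum_congr rfl fun x _ => Finset.sum_congr rfl fun y _ => by ring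
  · exact Finset.sum_congr rfl fun x _ => by ring

theorem ae_isingMeasure : ∀ᵐ t ∂isingMeasure, t = -1 ∨ t = 1 := by
  have hs : MeasurableSet {t : ℝ | ¬ (t = -1 ∨ t = 1)} :=
    ((measurableSet_singleton (-1 : ℝ)).union (measurableSet_singleton 1)).compl
  rw [ae_iff, isingMeasure, Measure.smul_apply, Measure.add_apply, Measure.dirac_apply' _ hs,
    Measure.dirac_apply' _ hs]
  simp

theorem integral_site_nonneg (hsymm : χ.map (fun t => -t) = χ)
    (hexp : ∀ c : ℝ, Integrable (fun t => Real.exp (c * t ^ 2)) χ)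
    {a M : ℝ} (ha : 0 < a) (hM : a * √2 ≤ M) (hWells : χ (Icc 0 a) ≤ χ (Ici (a * √2)))
    (e m n : ℕ) : 0 ≤ ∫ w : ℝ × ℝ, (clip M w.1 - a * w.2) ^ e *
      ((w.1 + a * w.2) ^ m * (w.1 - a * w.2) ^ n) ∂(χ.prod isingMeasure) := by
  have hM0 : 0 ≤ M := le_trans (by positivity) hM
  have hcm : Measurable (clip M) := (continuous_clip M).measurable
  have hmom : Integrable (fun w : ℝ × ℝ => (clip M w.1 - a * w.2) ^ e *
      ((w.1 + a * w.2) ^ m * (w.1 - a * w.2) ^ n)) (χ.prod isingMeasure) :=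
    integrable_site (p := fun w : ℝ × ℝ => w.1 + a * w.2) (q := fun w : ℝ × ℝ => w.1 - a * w.2)
      (G := fun w => (clip M w.1 - a * w.2) ^ e) (by fun_prop) (by fun_prop) (by fun_prop)
      (integrable_exp_duplicate hexp a) (C := e * 2) (fun w => by
        rw [abs_pow, mul_assoc, Real.exp_nat_mul]
        exact pow_le_pow_left₀ (abs_nonneg _) (abs_clip_sub_le hM0 _ _) e) m n
  rw [integral_prod_isingMeasure hmom]
  have := wells_site hsymm ha hM hWells (integrable_siteMoment hexp hM0 a e m n)
    (integrable_siteMoment hexp hM0 (-a) e m n)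
  unfold siteMoment at this
  simp only [mul_neg, mul_one]
  exact div_nonneg this zero_le_two

theorem integral_duplicate_nonneg (hsymm : χ.map (fun t => -t) = χ)
    (hexp : ∀ c : ℝ, Integrable (fun t => Real.exp (c * t ^ 2)) χ)
    {a M : ℝ} (ha : 0 < a) (hM : a * √2 ≤ M) (hWells : χ (Icc 0 a) ≤ χ (Ici (a * √2)))
    {J : V → V → ℝ} (hJ : ∀ x y, 0 ≤ J x y) {h h' : V → ℝ} (hh : ∀ x, |h' x| ≤ h x) (x₀ : V) :
    0 ≤ ∫ z : (V → ℝ) × (V → ℝ), (clip M (z.1 x₀) - a * z.2 x₀) *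
      Real.exp (pairForm J h z.1 +
        pairForm (fun x y => a ^ 2 * J x y) (fun x => a * h' x) z.2)
      ∂((Measure.pi fun _ : V => χ).prod (Measure.pi fun _ : V => isingMeasure)) := by
  have hM0 : 0 ≤ M := le_trans (by positivity) hM
  have hcm : Measurable (clip M) := (continuous_clip M).measurable
  have h0 : ∀ m n : ℕ, 0 ≤ ∫ w : ℝ × ℝ, (w.1 + a * w.2) ^ m * (w.1 - a * w.2) ^ n
      ∂(χ.prod isingMeasure) := fun m n => by
    simpa only [pow_zero, one_mul] using integral_site_nonneg hsymm hexp ha hM hWells 0 m n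
  have h1 : ∀ m n : ℕ, 0 ≤ ∫ w : ℝ × ℝ, (clip M w.1 - a * w.2) *
      ((w.1 + a * w.2) ^ m * (w.1 - a * w.2) ^ n) ∂(χ.prod isingMeasure) := fun m n => by
    simpa only [pow_one] using integral_site_nonneg hsymm hexp ha hM hWells 1 m n
  have hp : Measurable fun w : ℝ × ℝ => w.1 + a * w.2 := by fun_prop
  have hq : Measurable fun w : ℝ × ℝ => w.1 - a * w.2 := by fun_prop
  have hG : Measurable fun w : ℝ × ℝ => clip M w.1 - a * w.2 := by fun_prop
  have hJ' : ∀ x y, 0 ≤ J x y / 2 := fun x y => div_nonneg (hJ x y) zero_le_two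
  have hh₁ : ∀ x, 0 ≤ (h x + h' x) / 2 := fun x => by linarith [(abs_le.1 (hh x)).1]
  have hh₂ : ∀ x, 0 ≤ (h x - h' x) / 2 := fun x => by linarith [(abs_le.1 (hh x)).2]
  have key := ginibre_nonneg hp hq hG (integrable_exp_duplicate hexp a)
    (fun w => abs_clip_sub_le hM0 w.1 (a * w.2)) h0 h1 hJ' hh₁ hh₂ x₀
  have htr := (measurePreserving_arrowProdEquivProdArrow ℝ ℝ V (fun _ => χ)
    fun _ => isingMeasure).integral_comp' (g := fun z : (V → ℝ) × (V → ℝ) =>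
      (clip M (z.1 x₀) - a * z.2 x₀) * Real.exp (pairForm J h z.1 +
        pairForm (fun x y => a ^ 2 * J x y) (fun x => a * h' x) z.2))
  rw [← htr]
  have hsplit : ∀ ω : V → ℝ × ℝ,
      pairForm (fun x y => J x y / 2) (fun x => (h x + h' x) / 2)
        (fun x => (ω x).1 + a * (ω x).2) +
      pairForm (fun x y => J x y / 2) (fun x => (h x - h' x) / 2)
        (fun x => (ω x).1 - a * (ω x).2) =
      pairForm J h (fun x => (ω x).1) +
        pairForm (fun x y => a ^ 2 * J x y) (fun x => a * h' x) (fun x => (ω x).2) := fun ω => by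
    rw [← pairForm_const_mul J h' a, pairForm_add_pairForm J h h' fun x => (ω x).1]
  simp only [hsplit] at key
  exact key

/-- The comparison of Wells: in a finite volume the truncated magnetization dominates that of the
Ising model with spins `± a` and a smaller external field. -/
theorem wells_comparison (hsymm : χ.map (fun t => -t) = χ)
    (hexp : ∀ c : ℝ, Integrable (fun t => Real.exp (c * t ^ 2)) χ)
    {a M : ℝ} (ha : 0 < a) (hM : a * √2 ≤ M) (hWells : χ (Icc 0 a) ≤ χ (Ici (a * √2)))
    {J : V → V → ℝ} (hJ : ∀ x y, 0 ≤ J x y) {h h' : V → ℝ} (hh : ∀ x, |h' x| ≤ h x) (x₀ : V) :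
    (∫ s, Real.exp (pairForm J h s) ∂(Measure.pi fun _ : V => χ)) *
      (a * ∫ t, t x₀ * Real.exp (pairForm (fun x y => a ^ 2 * J x y) (fun x => a * h' x) t)
        ∂(Measure.pi fun _ : V => isingMeasure)) ≤
    (∫ s, clip M (s x₀) * Real.exp (pairForm J h s) ∂(Measure.pi fun _ : V => χ)) *
      ∫ t, Real.exp (pairForm (fun x y => a ^ 2 * J x y) (fun x => a * h' x) t)
        ∂(Measure.pi fun _ : V => isingMeasure) := by
  have hM0 : 0 ≤ M := le_trans (by positivity) hM
  have hcm : Measurable (clip M) := (continuous_clip M).measurable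
  have hexpI : ∀ c : ℝ, Integrable (fun t => Real.exp (c * t ^ 2)) isingMeasure :=
    fun c => integrable_isingMeasure _
  have key := integral_duplicate_nonneg hsymm hexp ha hM hWells hJ hh x₀
  set A := pairForm J h
  set B := pairForm (fun x y => a ^ 2 * J x y) (fun x => a * h' x)
  have i1 : Integrable (fun s : V → ℝ => clip M (s x₀) * Real.exp (A s))
      (Measure.pi fun _ : V => χ) :=
    integrable_mul_exp_pairForm_of_bound hexp J h (by fun_prop) fun s => abs_clip_le hM0 _
  have i2 : Integrable (fun s : V → ℝ => Real.exp (A s)) (Measure.pi fun _ : V => χ) :=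
    integrable_exp_pairForm hexp J h
  have i3 : Integrable (fun s : V → ℝ => Real.exp (B s))
      (Measure.pi fun _ : V => isingMeasure) :=
    integrable_exp_pairForm hexpI _ _
  have i4 : Integrable (fun t : V → ℝ => t x₀ * Real.exp (B t))
      (Measure.pi fun _ : V => isingMeasure) := by
    refine integrable_mul_exp_pairForm hexpI _ _ (c := 1) (by fun_prop) fun s => ?_
    refine (abs_le_exp_one_add_sq (s x₀)).trans (Real.exp_le_exp.2 ?_)
    rw [one_mul]
    exact one_add_sq_le_sum s x₀
  have e : (fun z : (V → ℝ) × (V → ℝ) =>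
      (clip M (z.1 x₀) - a * z.2 x₀) * Real.exp (A z.1 + B z.2)) = fun z =>
      (clip M (z.1 x₀) * Real.exp (A z.1)) * Real.exp (B z.2) -
      Real.exp (A z.1) * (a * (z.2 x₀ * Real.exp (B z.2))) := by
    ext z
    rw [Real.exp_add]
    ring
  rw [e, integral_sub (i1.mul_prod i3) (i2.mul_prod (i4.const_mul a)),
    integral_prod_mul (fun s => clip M (s x₀) * Real.exp (A s)) (fun t => Real.exp (B t)),
    integral_prod_mul (fun s => Real.exp (A s)) (fun t => a * (t x₀ * Real.exp (B t))),
    integral_const_mul] at key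
  linarith

end FiniteVolume

section Specification

variable {d : ℕ} {γ : Set (EuclideanSpace ℝ (Fin d))}

theorem countable_of_mem_configurations (hγ : γ ∈ configurations d) : γ.Countable := by
  have : γ = ⋃ n : ℕ, γ ∩ Metric.closedBall 0 n := by
    rw [← inter_iUnion, Metric.iUnion_closedBall_nat, inter_univ]
  rw [this]
  exact countable_iUnion fun n => (hγ _ (isCompact_closedBall _ _)).countable

theorem finite_of_isBounded (hγ : γ ∈ configurations d) {Λ : Set (EuclideanSpace ℝ (Fin d))}
    (hΛ : Bornology.IsBounded Λ) : {x : γ | (x : EuclideanSpace ℝ (Fin d)) ∈ Λ}.Finite := by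
  have h := hγ (closure Λ) hΛ.isCompact_closure
  refine Finite.of_finite_image (f := Subtype.val) (h.subset ?_) Subtype.val_injective.injOn
  rintro _ ⟨x, hx, rfl⟩
  exact ⟨x.2, subset_closure hx⟩

theorem mem_verticesIn (hγ : γ ∈ configurations d) {Λ : Set (EuclideanSpace ℝ (Fin d))}
    (hΛ : Bornology.IsBounded Λ) {x : γ} :
    x ∈ verticesIn γ Λ ↔ (x : EuclideanSpace ℝ (Fin d)) ∈ Λ := by
  rw [verticesIn, dif_pos (finite_of_isBounded hγ hΛ)]
  simp

theorem glue_coe {ι : Type*} (V : Finset ι) (s : V → ℝ) (σ' : ι → ℝ) (x : V) :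
    glue V s σ' x = s x := by
  simp [glue]

theorem glue_of_mem {ι : Type*} {V : Finset ι} (s : V → ℝ) (σ' : ι → ℝ) {x : ι} (hx : x ∈ V) :
    glue V s σ' x = s ⟨x, hx⟩ := by
  simp [glue, hx]

theorem glue_of_not_mem {ι : Type*} {V : Finset ι} (s : V → ℝ) (σ' : ι → ℝ) {x : ι}
    (hx : x ∉ V) : glue V s σ' x = σ' x := by
  simp [glue, hx]

theorem measurable_glue {ι : Type*} (V : Finset ι) (σ' : ι → ℝ) :
    Measurable fun s : V → ℝ => glue V s σ' := by
  refine measurable_pi_iff.2 fun x => ?_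
  by_cases hx : x ∈ V
  · simp only [glue_of_mem _ _ hx]
    fun_prop
  · simp only [glue_of_not_mem _ _ hx]
    fun_prop

open Classical in
/-- The interaction within `V`, symmetric over ordered pairs. -/
noncomputable def coupling (φ : ℝ≥0 → ℝ≥0) (β : ℝ) (V : Finset γ) (x y : V) : ℝ :=
  if x = y then 0 else β / 2 * φ (nndist x.1 y.1)

/-- The external field on `V` induced by the boundary condition. -/
noncomputable def boundaryField (φ : ℝ≥0 → ℝ≥0) (β : ℝ) (V : Finset γ) (σ' : γ → ℝ) (x : V) : ℝ :=
  β * ∑' y : {y : γ // y ∉ V}, (φ (nndist x.1 y.1) : ℝ) * σ' y.1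

theorem neg_mul_energy_glue (φ : ℝ≥0 → ℝ≥0) (β : ℝ) (V : Finset γ) (s : V → ℝ) (σ' : γ → ℝ) :
    -β * energy φ V (glue V s σ') =
      pairForm (coupling φ β V) (boundaryField φ β V σ') s := by
  classical
  unfold energy pairForm
  rw [neg_mul_neg, mul_add, Finset.mul_sum, Finset.mul_sum, Finset.mul_sum, ← Finset.sum_coe_sort V]
  congr 1
  · have h1 : V.offDiag = (V ×ˢ V).filter fun p => p.1 ≠ p.2 := by
      ext p
      simp [and_assoc]
    rw [h1, Finset.sum_filter, Finset.sum_product, ← Finset.sum_coe_sort V]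
    refine Finset.sum_congr rfl fun x _ => ?_
    rw [← Finset.sum_coe_sort V]
    refine Finset.sum_congr rfl fun y _ => ?_
    by_cases hxy : x = y
    · simp [coupling, hxy]
    · have : (x : γ) ≠ y := fun h => hxy (Subtype.ext h)
      simp only [coupling, hxy, glue_coe, if_false, ne_eq, this, not_false_eq_true, if_true]
      ring
  · refine Finset.sum_congr rfl fun x _ => ?_
    rw [boundaryField, mul_assoc, ← tsum_mul_right, glue_coe]
    refine congrArg (β * ·) (tsum_congr fun y => ?_)
    rw [glue_of_not_mem _ _ y.2]
    ring

variable {χ : Measure ℝ}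

/-- The weight of `V` in the form used for computations. -/
noncomputable def gibbsWeight (φ : ℝ≥0 → ℝ≥0) (β : ℝ) (V : Finset γ) (σ' : γ → ℝ) (s : V → ℝ) : ℝ :=
  Real.exp (pairForm (coupling φ β V) (boundaryField φ β V σ') s)

theorem gibbsWeight_nonneg (φ : ℝ≥0 → ℝ≥0) (β : ℝ) (V : Finset γ) (σ' : γ → ℝ) (s : V → ℝ) :
    0 ≤ gibbsWeight φ β V σ' s :=
  Real.exp_nonneg _

theorem measurable_gibbsWeight (φ : ℝ≥0 → ℝ≥0) (β : ℝ) (V : Finset γ) (σ' : γ → ℝ) :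
    Measurable (gibbsWeight φ β V σ') :=
  Real.measurable_exp.comp (measurable_pairForm _ _)

theorem boltzmann_eq (χ : Measure ℝ) (φ : ℝ≥0 → ℝ≥0) (β : ℝ) (V : Finset γ) (σ' : γ → ℝ) :
    boltzmann χ φ β V σ' = (Measure.pi fun _ : V => χ).withDensity
      fun s => ENNReal.ofReal (gibbsWeight φ β V σ' s) := by
  simp only [boltzmann, neg_mul_energy_glue, gibbsWeight]

theorem lintegral_gibbsKernel {Λ : Set (EuclideanSpace ℝ (Fin d))} (φ : ℝ≥0 → ℝ≥0) (β : ℝ)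
    (σ' : γ → ℝ) {g : (γ → ℝ) → ℝ≥0∞} (hg : Measurable g) :
    ∫⁻ σ, g σ ∂(gibbsKernel γ χ φ β Λ σ') =
      (boltzmann χ φ β (verticesIn γ Λ) σ' univ)⁻¹ *
        ∫⁻ s, ENNReal.ofReal (gibbsWeight φ β (verticesIn γ Λ) σ' s) *
          g (glue (verticesIn γ Λ) s σ') ∂(Measure.pi fun _ : verticesIn γ Λ => χ) := by
  have hm := measurable_glue (verticesIn γ Λ) σ'
  have hw := measurable_gibbsWeight φ β (verticesIn γ Λ) σ'
  rw [gibbsKernel, lintegral_smul_measure, lintegral_map hg hm, smul_eq_mul, boltzmann_eq,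
    lintegral_withDensity_eq_lintegral_mul (g := fun s => g (glue (verticesIn γ Λ) s σ')) _
      (by fun_prop) (hg.comp hm)]
  rfl

variable [IsFiniteMeasure χ]

theorem boltzmann_univ (hexp : ∀ c : ℝ, Integrable (fun t => Real.exp (c * t ^ 2)) χ)
    (φ : ℝ≥0 → ℝ≥0) (β : ℝ) (V : Finset γ) (σ' : γ → ℝ) :
    boltzmann χ φ β V σ' univ =
      ENNReal.ofReal (∫ s, gibbsWeight φ β V σ' s ∂(Measure.pi fun _ : V => χ)) := by
  rw [boltzmann_eq, withDensity_apply _ MeasurableSet.univ, Measure.restrict_univ,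
    ofReal_integral_eq_lintegral_ofReal (f := gibbsWeight φ β V σ')
      (integrable_exp_pairForm hexp _ _) (ae_of_all _ fun s => Real.exp_nonneg _)]

theorem partition_pos [NeZero χ] (hexp : ∀ c : ℝ, Integrable (fun t => Real.exp (c * t ^ 2)) χ)
    (φ : ℝ≥0 → ℝ≥0) (β : ℝ) (V : Finset γ) (σ' : γ → ℝ) :
    0 < ∫ s, gibbsWeight φ β V σ' s ∂(Measure.pi fun _ : V => χ) := by
  have : NeZero (Measure.pi fun _ : V => χ) := ⟨by
    rw [Ne, ← Measure.measure_univ_eq_zero, Measure.pi_univ, Finset.prod_eq_zero_iff]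
    simp [NeZero.ne χ]⟩
  exact integral_exp_pos (integrable_exp_pairForm hexp _ _)

theorem partition_nonneg (χ : Measure ℝ) (φ : ℝ≥0 → ℝ≥0) (β : ℝ) (V : Finset γ) (σ' : γ → ℝ) :
    0 ≤ ∫ s, gibbsWeight φ β V σ' s ∂(Measure.pi fun _ : V => χ) :=
  integral_nonneg fun _ => Real.exp_nonneg _

theorem isProbabilityMeasure_gibbsKernel [NeZero χ]
    (hexp : ∀ c : ℝ, Integrable (fun t => Real.exp (c * t ^ 2)) χ)
    (φ : ℝ≥0 → ℝ≥0) (β : ℝ) (Λ : Set (EuclideanSpace ℝ (Fin d))) (σ' : γ → ℝ) :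
    IsProbabilityMeasure (gibbsKernel γ χ φ β Λ σ') := by
  refine ⟨?_⟩
  rw [gibbsKernel, Measure.smul_apply, Measure.map_apply (measurable_glue _ _) MeasurableSet.univ,
    preimage_univ, smul_eq_mul]
  refine ENNReal.inv_mul_cancel ?_ ?_
  · rw [boltzmann_univ hexp]
    exact (ENNReal.ofReal_pos.2 (partition_pos hexp _ _ _ _)).ne'
  · rw [boltzmann_univ hexp]
    exact ENNReal.ofReal_ne_top

theorem integral_gibbsKernel (hexp : ∀ c : ℝ, Integrable (fun t => Real.exp (c * t ^ 2)) χ)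
    {Λ : Set (EuclideanSpace ℝ (Fin d))} (φ : ℝ≥0 → ℝ≥0) (β : ℝ)
    (σ' : γ → ℝ) {g : (γ → ℝ) → ℝ} (hg : Measurable g) :
    ∫ σ, g σ ∂(gibbsKernel γ χ φ β Λ σ') =
      (∫ s, gibbsWeight φ β (verticesIn γ Λ) σ' s ∂(Measure.pi fun _ : verticesIn γ Λ => χ))⁻¹ *
        ∫ s, g (glue (verticesIn γ Λ) s σ') * gibbsWeight φ β (verticesIn γ Λ) σ' s
          ∂(Measure.pi fun _ : verticesIn γ Λ => χ) := by
  have hw := measurable_gibbsWeight φ β (verticesIn γ Λ) σ'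
  rw [gibbsKernel, integral_smul_measure,
    integral_map (measurable_glue _ _).aemeasurable hg.aestronglyMeasurable, boltzmann_univ hexp,
    boltzmann_eq, integral_withDensity_eq_integral_toReal_smul (by fun_prop)
      (ae_of_all _ fun s => ENNReal.ofReal_lt_top), ENNReal.toReal_inv, ENNReal.toReal_ofReal
      (partition_nonneg _ _ _ _ _), smul_eq_mul]
  congr 1
  refine integral_congr_ae (ae_of_all _ fun s => ?_)
  simp only [smul_eq_mul]
  rw [ENNReal.toReal_ofReal (gibbsWeight_nonneg _ _ _ _ _), mul_comm]

end Specification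

section SuperGaussian

theorem mul_sq_le_rpow {u ϰ : ℝ} (hu : 2 < u) (hϰ : 0 < ϰ) {c : ℝ} (hc : 0 ≤ c) (t : ℝ) :
    c * t ^ 2 ≤ ϰ * |t| ^ u + c * (c / ϰ) ^ (2 / (u - 2)) := by
  have hu2 : 0 < u - 2 := by linarith
  set R := (c / ϰ) ^ (1 / (u - 2)) with hR
  have hR0 : 0 ≤ R := by positivity
  have hR2 : (c / ϰ) ^ (2 / (u - 2)) = R ^ 2 := by
    rw [hR, ← Real.rpow_natCast, ← Real.rpow_mul (by positivity)]
    congr 1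
    push_cast
    ring
  rw [hR2]
  have hpow : 0 ≤ ϰ * |t| ^ u := by positivity
  rcases le_or_gt |t| R with h | h
  · have : t ^ 2 ≤ R ^ 2 := sq_le_sq' (abs_le.1 h).1 (abs_le.1 h).2
    nlinarith
  · have ht : 0 < |t| := hR0.trans_lt h
    have h1 : c / ϰ ≤ |t| ^ (u - 2) := by
      calc c / ϰ = R ^ (u - 2) := by
            rw [hR, ← Real.rpow_mul (by positivity), one_div_mul_cancel hu2.ne', Real.rpow_one]
        _ ≤ |t| ^ (u - 2) := Real.rpow_le_rpow hR0 h.le hu2.le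
    have h2 : |t| ^ u = |t| ^ (u - 2) * t ^ 2 := by
      rw [← sq_abs t, ← Real.rpow_natCast |t| 2, ← Real.rpow_add ht]
      congr 1
      push_cast
      ring
    rw [div_le_iff₀ hϰ] at h1
    rw [h2]
    have : c * t ^ 2 ≤ |t| ^ (u - 2) * ϰ * t ^ 2 := mul_le_mul_of_nonneg_right h1 (sq_nonneg t)
    have : 0 ≤ c * R ^ 2 := by positivity
    linarith

theorem integrable_exp_sq {χ : Measure ℝ} {u ϰ : ℝ} (hu : 2 < u) (hϰ : 0 < ϰ)
    (hχ : Integrable (fun t => Real.exp (ϰ * |t| ^ u)) χ) (c : ℝ) :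
    Integrable (fun t => Real.exp (c * t ^ 2)) χ := by
  refine (hχ.const_mul (Real.exp (|c| * (|c| / ϰ) ^ (2 / (u - 2))))).mono' (by fun_prop)
    (ae_of_all _ fun t => ?_)
  rw [Real.norm_eq_abs, Real.abs_exp, ← Real.exp_add, Real.exp_le_exp]
  have h1 : c * t ^ 2 ≤ |c| * t ^ 2 := mul_le_mul_of_nonneg_right (le_abs_self c) (sq_nonneg t)
  linarith [mul_sq_le_rpow hu hϰ (abs_nonneg c) t]

end SuperGaussian

section Comparison

variable {d : ℕ} {γ : Set (EuclideanSpace ℝ (Fin d))}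

theorem isBoundedBorel_singleton (x : EuclideanSpace ℝ (Fin d)) :
    IsBoundedBorel ({x} : Set (EuclideanSpace ℝ (Fin d))) :=
  ⟨Bornology.isBounded_singleton, measurableSet_singleton x⟩

theorem finite_nndist_le (hγ : γ ∈ configurations d) (r : ℝ≥0) (x : γ) :
    {y : γ | nndist x y ≤ r}.Finite := by
  refine (finite_of_isBounded hγ (Metric.isBounded_closedBall (x := (x : EuclideanSpace ℝ (Fin d)))
    (r := r))).subset fun y hy => ?_
  rw [mem_ofPred_eq, Metric.mem_closedBall, dist_comm]
  exact hy

theorem summable_interaction (hγ : γ ∈ configurations d) {φ : ℝ≥0 → ℝ≥0} {r : ℝ≥0}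
    (hφzero : ∀ t, r < t → φ t = 0) (V : Finset γ) (x : γ) (f : γ → ℝ) :
    Summable fun y : {y : γ // y ∉ V} => (φ (nndist x y.1) : ℝ) * f y.1 := by
  refine summable_of_hasFiniteSupport (((finite_nndist_le hγ r x).preimage
    (f := fun y : {y : γ // y ∉ V} => y.1) Subtype.val_injective.injOn).subset fun y hy => ?_)
  by_contra h
  refine hy ?_
  have : r < nndist x y.1 := not_le.1 h
  simp [hφzero _ this]

variable {φ : ℝ≥0 → ℝ≥0} {r : ℝ≥0}

theorem abs_boundaryField_le (hγ : γ ∈ configurations d) (hφzero : ∀ t, r < t → φ t = 0)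
    {β a : ℝ} (hβ : 0 ≤ β) (V : Finset γ) {τ : γ → ℝ} (hτ : ∀ y, |τ y| ≤ a) (x : V) :
    |boundaryField φ β V τ x| ≤ boundaryField φ β V (fun _ => a) x := by
  unfold boundaryField
  rw [abs_mul, abs_of_nonneg hβ]
  refine mul_le_mul_of_nonneg_left ?_ hβ
  have hle : ∀ y : {y : γ // y ∉ V},
      ‖(φ (nndist x.1 y.1) : ℝ) * τ y.1‖ ≤ (φ (nndist x.1 y.1) : ℝ) * a := fun y => by
    rw [Real.norm_eq_abs, abs_mul, NNReal.abs_eq]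
    exact mul_le_mul_of_nonneg_left (hτ y) (NNReal.coe_nonneg _)
  exact tsum_of_norm_bounded (summable_interaction hγ hφzero V x fun _ => a).hasSum hle

theorem coupling_nonneg {β : ℝ} (hβ : 0 ≤ β) (V : Finset γ) (x y : V) : 0 ≤ coupling φ β V x y := by
  unfold coupling
  split_ifs
  · exact le_rfl
  · positivity

theorem coupling_mul (c β : ℝ) (V : Finset γ) (x y : V) :
    coupling φ (c * β) V x y = c * coupling φ β V x y := by
  unfold coupling
  split_ifs
  · simp
  · ring

theorem boundaryField_mul (c β : ℝ) (V : Finset γ) (τ : γ → ℝ) (x : V) :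
    boundaryField φ (c ^ 2 * β) V τ x = c * boundaryField φ β V (fun y => c * τ y) x := by
  unfold boundaryField
  have : ∀ y : {y : γ // y ∉ V}, (φ (nndist x.1 y.1) : ℝ) * (c * τ y.1) =
      c * ((φ (nndist x.1 y.1) : ℝ) * τ y.1) := fun y => by ring
  simp only [this]
  rw [tsum_mul_left]
  ring

/-- The comparison of Wells for the Gibbs specifications. -/
theorem wells_gibbsKernel (hγ : γ ∈ configurations d) (hφzero : ∀ t, r < t → φ t = 0)
    {χ : Measure ℝ} [IsFiniteMeasure χ] [NeZero χ] (hsymm : χ.map (fun t => -t) = χ)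
    (hexp : ∀ c : ℝ, Integrable (fun t => Real.exp (c * t ^ 2)) χ)
    {β : ℝ} (hβ : 0 ≤ β) {a M : ℝ} (ha : 0 < a) (hM : a * √2 ≤ M)
    (hWells : χ (Icc 0 a) ≤ χ (Ici (a * √2)))
    {Λ : Set (EuclideanSpace ℝ (Fin d))} (hΛ : Bornology.IsBounded Λ) {x : γ}
    (hx : (x : EuclideanSpace ℝ (Fin d)) ∈ Λ) {τ : γ → ℝ} (hτ : ∀ y, |τ y| ≤ 1) :
    a * ∫ σ, σ x ∂(gibbsKernel γ isingMeasure φ (a ^ 2 * β) Λ τ) ≤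
      ∫ σ, clip M (σ x) ∂(gibbsKernel γ χ φ β Λ fun _ => a) := by
  have hcm : Measurable (clip M) := (continuous_clip M).measurable
  have hexpI : ∀ c : ℝ, Integrable (fun t => Real.exp (c * t ^ 2)) isingMeasure :=
    fun c => integrable_isingMeasure _
  have hxV : x ∈ verticesIn γ Λ := (mem_verticesIn hγ hΛ).2 hx
  rw [integral_gibbsKernel hexpI φ _ τ (g := fun σ => σ x) (by fun_prop),
    integral_gibbsKernel hexp φ β _ (g := fun σ => clip M (σ x)) (by fun_prop)]
  simp only [glue_of_mem _ _ hxV]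
  have hZ := partition_pos hexp φ β (verticesIn γ Λ) fun _ => a
  have hZI := partition_pos hexpI φ (a ^ 2 * β) (verticesIn γ Λ) τ
  have key := wells_comparison hsymm hexp ha hM hWells
    (fun x y => coupling_nonneg (φ := φ) hβ (verticesIn γ Λ) x y)
    (fun x => abs_boundaryField_le hγ hφzero hβ (verticesIn γ Λ) (a := a)
      (τ := fun y => a * τ y) (fun y => by
        rw [abs_mul, abs_of_pos ha]
        exact mul_le_of_le_one_right ha.le (hτ y)) x) ⟨x, hxV⟩
  simp only [← coupling_mul, ← boundaryField_mul] at key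
  rw [← mul_assoc, mul_comm a, mul_assoc, inv_mul_le_iff₀ hZI, ← mul_assoc, mul_comm (∫ s, _ ∂_),
    mul_assoc, le_inv_mul_iff₀ hZ]
  refine key.trans_eq ?_
  rw [mul_comm]
  rfl

theorem ae_gibbsKernel_ising (hγ : γ ∈ configurations d) {β : ℝ}
    {Λ : Set (EuclideanSpace ℝ (Fin d))} (hΛ : Bornology.IsBounded Λ) {x : γ}
    (hx : (x : EuclideanSpace ℝ (Fin d)) ∈ Λ) (τ : γ → ℝ) :
    ∀ᵐ σ ∂(gibbsKernel γ isingMeasure φ β Λ τ), σ x = -1 ∨ σ x = 1 := by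
  have hxV : x ∈ verticesIn γ Λ := (mem_verticesIn hγ hΛ).2 hx
  have hs : MeasurableSet {σ : γ → ℝ | σ x = -1 ∨ σ x = 1} :=
    (measurableSet_eq_fun (by fun_prop) measurable_const).union
      (measurableSet_eq_fun (by fun_prop) measurable_const)
  refine Measure.ae_smul_measure ?_ _
  rw [ae_map_iff (measurable_glue _ _).aemeasurable hs, boltzmann_eq]
  refine (withDensity_absolutelyContinuous _ _).ae_le ?_
  simp only [glue_of_mem _ _ hxV]
  exact (Measure.tendsto_eval_ae_ae (μ := fun _ : verticesIn γ Λ => isingMeasure)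
    (i := ⟨x, hxV⟩)).eventually ae_isingMeasure

theorem integral_of_ae_ising {P : Measure (γ → ℝ)} [IsProbabilityMeasure P] {x : γ}
    (h : ∀ᵐ σ ∂P, σ x = -1 ∨ σ x = 1) :
    Integrable (fun σ : γ → ℝ => σ x) P ∧ ∫ σ, σ x ∂P = 2 * P.real {σ | σ x = 1} - 1 := by
  have hs : MeasurableSet {σ : γ → ℝ | σ x = 1} :=
    measurableSet_eq_fun (by fun_prop) measurable_const
  have hi : Integrable ({σ : γ → ℝ | σ x = 1}.indicator (1 : (γ → ℝ) → ℝ)) P :=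
    (integrable_const 1).indicator hs
  have he : (fun σ : γ → ℝ => σ x) =ᵐ[P]
      fun σ => 2 * {σ : γ → ℝ | σ x = 1}.indicator (1 : (γ → ℝ) → ℝ) σ - 1 := by
    filter_upwards [h] with σ hσ
    rcases hσ with hσ | hσ
    · norm_num [indicator_apply, hσ]
    · norm_num [indicator_apply, hσ]
  have hint := (hi.const_mul 2).sub (integrable_const (1 : ℝ))
  refine ⟨hint.congr he.symm, ?_⟩
  rw [integral_congr_ae he, integral_sub (hi.const_mul 2) (integrable_const _),
    integral_const_mul, integral_indicator_one hs]
  simp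

theorem ae_isingGibbs (hγ : γ ∈ configurations d) {β : ℝ} {ν : Measure (γ → ℝ)}
    (hν : ν ∈ gibbsMeasures γ isingMeasure φ β) (x : γ) : ∀ᵐ σ ∂ν, σ x = -1 ∨ σ x = 1 := by
  have hs : MeasurableSet {σ : γ → ℝ | ¬ (σ x = -1 ∨ σ x = 1)} :=
    ((measurableSet_eq_fun (by fun_prop) measurable_const).union
      (measurableSet_eq_fun (by fun_prop) measurable_const)).compl
  rw [ae_iff, hν.2 {x.1} (isBoundedBorel_singleton _) _ hs]
  have : ∀ τ, gibbsKernel γ isingMeasure φ β {x.1} τ {σ : γ → ℝ | ¬ (σ x = -1 ∨ σ x = 1)} = 0 :=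
    fun τ => ae_gibbsKernel_ising hγ (isBoundedBorel_singleton _).1 rfl τ
  simp only [this, lintegral_zero]

theorem isingGibbs_le (hγ : γ ∈ configurations d) (hφzero : ∀ t, r < t → φ t = 0)
    {χ : Measure ℝ} [IsFiniteMeasure χ] [NeZero χ] (hsymm : χ.map (fun t => -t) = χ)
    (hexp : ∀ c : ℝ, Integrable (fun t => Real.exp (c * t ^ 2)) χ)
    {β : ℝ} (hβ : 0 ≤ β) {a M : ℝ} (ha : 0 < a) (hM : a * √2 ≤ M)
    (hWells : χ (Icc 0 a) ≤ χ (Ici (a * √2)))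
    {Λ : Set (EuclideanSpace ℝ (Fin d))} (hΛ : IsBoundedBorel Λ) {x : γ}
    (hx : (x : EuclideanSpace ℝ (Fin d)) ∈ Λ) {ν : Measure (γ → ℝ)}
    (hν : ν ∈ gibbsMeasures γ isingMeasure φ (a ^ 2 * β)) :
    a * ∫ σ, σ x ∂ν ≤ ∫ σ, clip M (σ x) ∂(gibbsKernel γ χ φ β Λ fun _ => a) := by
  have : IsProbabilityMeasure ν := hν.1
  have : Countable γ := (countable_of_mem_configurations hγ).to_subtype
  have hexpI : ∀ c : ℝ, Integrable (fun t => Real.exp (c * t ^ 2)) isingMeasure :=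
    fun c => integrable_isingMeasure _
  have hs : MeasurableSet {σ : γ → ℝ | σ x = 1} :=
    measurableSet_eq_fun (by fun_prop) measurable_const
  set I := ∫ σ, clip M (σ x) ∂(gibbsKernel γ χ φ β Λ fun _ => a)
  have hker : ∀ τ : γ → ℝ, (∀ y, |τ y| ≤ 1) →
      gibbsKernel γ isingMeasure φ (a ^ 2 * β) Λ τ {σ | σ x = 1} ≤
        ENNReal.ofReal ((I / a + 1) / 2) := fun τ hτ => by
    have : IsProbabilityMeasure (gibbsKernel γ isingMeasure φ (a ^ 2 * β) Λ τ) :=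
      isProbabilityMeasure_gibbsKernel hexpI φ _ Λ τ
    have h1 := wells_gibbsKernel hγ hφzero hsymm hexp hβ ha hM hWells hΛ.1 hx hτ
    rw [(integral_of_ae_ising (ae_gibbsKernel_ising hγ hΛ.1 hx τ)).2, mul_comm,
      ← le_div_iff₀ ha] at h1
    rw [← ofReal_measureReal]
    refine ENNReal.ofReal_le_ofReal ?_
    linarith
  have hτae : ∀ᵐ τ ∂ν, ∀ y, |τ y| ≤ 1 := by
    refine ae_all_iff.2 fun y => ?_
    filter_upwards [ae_isingGibbs hγ hν y] with τ hτ
    rcases hτ with h | h <;> simp [h]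
  have hle : ν {σ | σ x = 1} ≤ ENNReal.ofReal ((I / a + 1) / 2) := by
    rw [hν.2 Λ hΛ _ hs]
    refine (lintegral_mono_ae (hτae.mono fun τ hτ => hker τ hτ)).trans ?_
    simp
  have hpos : 0 ≤ (I / a + 1) / 2 := by
    have h1 := wells_gibbsKernel hγ hφzero hsymm hexp hβ ha hM hWells hΛ.1 hx (τ := fun _ => 0)
      (by simp)
    have : IsProbabilityMeasure (gibbsKernel γ isingMeasure φ (a ^ 2 * β) Λ fun _ => 0) :=
      isProbabilityMeasure_gibbsKernel hexpI φ _ Λ _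
    rw [(integral_of_ae_ising (ae_gibbsKernel_ising hγ hΛ.1 hx _)).2, mul_comm,
      ← le_div_iff₀ ha] at h1
    have := measureReal_nonneg (μ := gibbsKernel γ isingMeasure φ (a ^ 2 * β) Λ fun _ => 0)
      (s := {σ | σ x = 1})
    linarith
  have hreal : ν.real {σ | σ x = 1} ≤ (I / a + 1) / 2 := by
    rw [measureReal_def, ← ENNReal.toReal_ofReal hpos]
    exact ENNReal.toReal_mono ENNReal.ofReal_ne_top hle
  rw [(integral_of_ae_ising (ae_isingGibbs hγ hν x)).2, mul_comm, ← le_div_iff₀ ha]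
  linarith

end Comparison

section Limit

variable {d : ℕ} {γ : Set (EuclideanSpace ℝ (Fin d))}

theorem isLocalSet_eval_preimage (x : γ) {S : Set ℝ} (hS : MeasurableSet S) :
    IsLocalSet {σ : γ → ℝ | σ x ∈ S} :=
  ⟨{x.1}, isBoundedBorel_singleton _, {τ | τ ⟨x, rfl⟩ ∈ S},
    (measurable_pi_apply _) hS, rfl⟩

theorem neZero_of_mem_gibbsMeasures {χ : Measure ℝ} {φ : ℝ≥0 → ℝ≥0} {β : ℝ}
    (hγ : γ ∈ configurations d) (x : γ) {μ : Measure (γ → ℝ)} (hμ : μ ∈ gibbsMeasures γ χ φ β) :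
    NeZero χ := by
  refine ⟨fun h0 => ?_⟩
  subst h0
  have := hμ.1
  have h := hμ.2 {x.1} (isBoundedBorel_singleton _) univ MeasurableSet.univ
  have hx : x ∈ verticesIn γ {x.1} := (mem_verticesIn hγ (isBoundedBorel_singleton _).1).2 rfl
  have hpi : (Measure.pi fun _ : verticesIn γ {x.1} => (0 : Measure ℝ)) = 0 := by
    rw [← Measure.measure_univ_eq_zero, Measure.pi_univ]
    exact Finset.prod_eq_zero (Finset.mem_univ ⟨x, hx⟩) (by simp)
  simp [gibbsKernel, boltzmann_eq, hpi] at h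

theorem tendsto_eval_preimage {ι : Type*} {l : Filter ι} {P : ι → Measure (γ → ℝ)}
    {μ : Measure (γ → ℝ)} (h : Tendsto P l (@nhds _ (localTopology γ) μ)) (x : γ) {S : Set ℝ}
    (hS : MeasurableSet S) :
    Tendsto (fun n => (P n).map (fun σ => σ x) S) l (𝓝 (μ.map (fun σ => σ x) S)) := by
  have e : ∀ R : Measure (γ → ℝ), R.map (fun σ => σ x) S = R {σ | σ x ∈ S} := fun R =>
    Measure.map_apply (measurable_pi_apply x) hS
  simp only [e]
  exact tendsto_localTopology_iff.1 h _ (isLocalSet_eval_preimage x hS)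

theorem tendsto_integral_eval {P : ℕ → Measure (γ → ℝ)} [∀ n, IsProbabilityMeasure (P n)]
    {μ : Measure (γ → ℝ)} [IsProbabilityMeasure μ]
    (h : Tendsto P atTop (@nhds _ (localTopology γ) μ)) (x : γ) {f : ℝ → ℝ} (hf : Continuous f)
    {C : ℝ} (hC : ∀ t, |f t| ≤ C) :
    Tendsto (fun n => ∫ σ, f (σ x) ∂(P n)) atTop (𝓝 (∫ σ, f (σ x) ∂μ)) := by
  have hm : Measurable fun σ : γ → ℝ => σ x := measurable_pi_apply x
  have hpm : ∀ Q : Measure (γ → ℝ), IsProbabilityMeasure Q →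
      IsProbabilityMeasure (Q.map fun σ => σ x) := fun Q hQ =>
    Measure.isProbabilityMeasure_map hm.aemeasurable
  let Q : ℕ → ProbabilityMeasure ℝ := fun n => ⟨(P n).map fun σ => σ x, hpm _ inferInstance⟩
  let Q' : ProbabilityMeasure ℝ := ⟨μ.map fun σ => σ x, hpm _ inferInstance⟩
  have hQ : Tendsto Q atTop (𝓝 Q') := by
    refine tendsto_of_forall_isOpen_le_liminf fun G hG => ?_
    have h1 : Tendsto (fun n => Q n G) atTop (𝓝 (Q' G)) := by
      rw [← ENNReal.tendsto_coe]
      simp only [ProbabilityMeasure.ennreal_coeFn_eq_coeFn_toMeasure]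
      exact tendsto_eval_preimage h x hG.measurableSet
    exact h1.liminf_eq.ge
  have h2 := ProbabilityMeasure.tendsto_iff_forall_integral_tendsto.1 hQ
    (BoundedContinuousFunction.ofNormedAddCommGroup f hf C hC)
  have e : ∀ R : Measure (γ → ℝ), (∫ t, f t ∂(R.map fun σ => σ x)) = (∫ σ, f (σ x) ∂ R) := fun R =>
    integral_map hm.aemeasurable hf.aestronglyMeasurable
  simpa [Q, Q', e] using h2

theorem integral_ge_of_isLimitingState (hγ : γ ∈ configurations d) {φ : ℝ≥0 → ℝ≥0} {r : ℝ≥0}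
    (hφzero : ∀ t, r < t → φ t = 0)
    {χ : Measure ℝ} [IsFiniteMeasure χ] [NeZero χ] (hsymm : χ.map (fun t => -t) = χ)
    (hexp : ∀ c : ℝ, Integrable (fun t => Real.exp (c * t ^ 2)) χ)
    {β : ℝ} (hβ : 0 ≤ β) {a : ℝ} (ha : 0 < a) (hWells : χ (Icc 0 a) ≤ χ (Ici (a * √2)))
    {μ ν : Measure (γ → ℝ)} (hμ : IsLimitingState γ χ φ β a μ)
    (hν : ν ∈ gibbsMeasures γ isingMeasure φ (a ^ 2 * β)) {x : γ}
    (hint : Integrable (fun σ : γ → ℝ => σ x) μ) :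
    a * ∫ σ, σ x ∂ν ≤ ∫ σ, σ x ∂μ := by
  obtain ⟨hμG, Λ, hΛ, hlim⟩ := hμ
  have := hμG.1
  have : ∀ n, IsProbabilityMeasure (gibbsKernel γ χ φ β (Λ n) fun _ => a) := fun n =>
    isProbabilityMeasure_gibbsKernel hexp φ β (Λ n) _
  obtain ⟨n₀, hn₀⟩ := hΛ.2.2 {x.1} (isBoundedBorel_singleton _)
  have hmono : Monotone Λ := monotone_nat_of_le_succ hΛ.2.1
  have hclip : ∀ M, a * √2 ≤ M → a * ∫ σ, σ x ∂ν ≤ ∫ σ, clip M (σ x) ∂μ := fun M hM => by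
    have hM0 : 0 ≤ M := le_trans (by positivity) hM
    refine ge_of_tendsto (tendsto_integral_eval hlim x (continuous_clip M) (abs_clip_le hM0)) ?_
    filter_upwards [eventually_ge_atTop n₀] with n hn
    exact isingGibbs_le hγ hφzero hsymm hexp hβ ha hM hWells (hΛ.1 n) (hmono hn (hn₀ rfl)) hν
  have htend : Tendsto (fun M : ℝ => ∫ σ, clip M (σ x) ∂μ) atTop (𝓝 (∫ σ, σ x ∂μ)) := by
    refine tendsto_integral_filter_of_dominated_convergence (fun σ => |σ x|) ?_ ?_ hint.abs ?_
    · exact Eventually.of_forall fun M =>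
        ((continuous_clip M).measurable.comp (measurable_pi_apply x)).aestronglyMeasurable
    · filter_upwards [eventually_ge_atTop (0 : ℝ)] with M hM
      exact ae_of_all _ fun σ => abs_clip_le_abs hM _
    · refine ae_of_all _ fun σ => tendsto_const_nhds.congr' ?_
      filter_upwards [eventually_ge_atTop |σ x|] with M hM
      exact (clip_eq_self hM).symm
  refine ge_of_tendsto htend ?_
  filter_upwards [eventually_ge_atTop (a * √2)] with M hM
  exact hclip M hM

end Limit

section SiteMoment

/-- The constant that controls the second moment of a spin in an external field. -/
noncomputable def momentConstant (χ : Measure ℝ) (ϰ u : ℝ) : ℝ :=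
  |Real.log ((∫ t, Real.exp (ϰ * |t| ^ u) ∂χ) / χ.real univ)|

theorem measureReal_univ_le_integral_exp_mul {χ : Measure ℝ} [IsFiniteMeasure χ]
    (hsymm : χ.map (fun t => -t) = χ)
    (hexp : ∀ c : ℝ, Integrable (fun t => Real.exp (c * t ^ 2)) χ) (g : ℝ)
    (hg : Integrable (fun t => Real.exp (t * g)) χ) :
    χ.real univ ≤ ∫ t, Real.exp (t * g) ∂χ := by
  have hid : Integrable (fun t : ℝ => t) χ := by
    refine ((hexp 1).const_mul (Real.exp 1)).mono' (by fun_prop) (ae_of_all _ fun t => ?_)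
    rw [← Real.exp_add, one_mul]
    exact abs_le_exp_one_add_sq t
  have h0 : ∫ t, t ∂χ = 0 := by
    have := integral_comp_neg_of_map_neg hsymm fun t => t
    rw [integral_neg] at this
    linarith
  have h1 : ∫ t, (1 + t * g) ∂χ = χ.real univ := by
    rw [integral_add (integrable_const _) (hid.mul_const g), integral_mul_const, h0]
    simp
  rw [← h1]
  refine integral_mono ((integrable_const _).add (hid.mul_const g)) hg fun t => ?_
  have := Real.add_one_le_exp (t * g)
  simp only
  linarith

theorem integral_sq_mul_exp_le {χ : Measure ℝ} [IsFiniteMeasure χ] [NeZero χ]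
    (hsymm : χ.map (fun t => -t) = χ) {u ϰ : ℝ} (hu : 2 < u) (hϰ : 0 < ϰ)
    (hχ : Integrable (fun t => Real.exp (ϰ * |t| ^ u)) χ) {L : ℝ} (hL : 1 ≤ L) (g : ℝ) :
    Integrable (fun t => Real.exp (t * g)) χ ∧ Integrable (fun t => t ^ 2 * Real.exp (t * g)) χ ∧
    ∫ t, t ^ 2 * Real.exp (t * g) ∂χ ≤
      (momentConstant χ ϰ u + 2 * (2 * L / ϰ) ^ (2 / (u - 2)) + (4 * L ^ 2)⁻¹ * g ^ 2) *
        ∫ t, Real.exp (t * g) ∂χ := by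
  have hexp := integrable_exp_sq hu hϰ hχ
  have hL0 : 0 < L := by linarith
  have hlin : ∀ t : ℝ, t * g ≤ L * t ^ 2 + g ^ 2 / (4 * L) := fun t => by
    have : L * t ^ 2 + g ^ 2 / (4 * L) - t * g = (2 * L * t - g) ^ 2 / (4 * L) := by
      field_simp
      ring
    have h2 : 0 ≤ (2 * L * t - g) ^ 2 / (4 * L) := by positivity
    linarith
  have i1 : Integrable (fun t => Real.exp (t * g)) χ := by
    refine ((hexp L).const_mul (Real.exp (g ^ 2 / (4 * L)))).mono' (by fun_prop)
      (ae_of_all _ fun t => ?_)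
    rw [Real.norm_eq_abs, Real.abs_exp, ← Real.exp_add, Real.exp_le_exp]
    linarith [hlin t]
  have i2 : Integrable (fun t => Real.exp (L * t ^ 2) * Real.exp (t * g)) χ := by
    refine ((hexp (2 * L)).const_mul (Real.exp (g ^ 2 / (4 * L)))).mono' (by fun_prop)
      (ae_of_all _ fun t => ?_)
    rw [Real.norm_eq_abs, abs_mul, Real.abs_exp, Real.abs_exp, ← Real.exp_add, ← Real.exp_add,
      Real.exp_le_exp]
    linarith [hlin t]
  have i3 : Integrable (fun t => t ^ 2 * Real.exp (t * g)) χ := by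
    refine i2.mono' (by fun_prop) (ae_of_all _ fun t => ?_)
    rw [Real.norm_eq_abs, abs_mul, Real.abs_exp, abs_of_nonneg (sq_nonneg t)]
    refine mul_le_mul_of_nonneg_right ?_ (Real.exp_nonneg _)
    have := Real.add_one_le_exp (L * t ^ 2)
    nlinarith [sq_nonneg t]
  refine ⟨i1, i3, ?_⟩
  set K := ∫ t, Real.exp (ϰ * |t| ^ u) ∂χ with hK
  have hK0 : 0 < K := integral_exp_pos hχ
  have hχ0 : 0 < χ.real univ := by
    rw [measureReal_def]
    exact ENNReal.toReal_pos (by simp [NeZero.ne χ]) (measure_ne_top _ _)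
  set D := momentConstant χ ϰ u with hD
  have hDK : K ≤ Real.exp D * χ.real univ := by
    rw [← div_le_iff₀ hχ0]
    calc K / χ.real univ = Real.exp (Real.log (K / χ.real univ)) :=
          (Real.exp_log (div_pos hK0 hχ0)).symm
      _ ≤ Real.exp D := Real.exp_le_exp.2 (le_abs_self _)
  set R := 2 * L * (2 * L / ϰ) ^ (2 / (u - 2)) with hR
  set E := D + R + g ^ 2 / (4 * L) with hE
  have hexpint : ∫ t, Real.exp (L * t ^ 2) * Real.exp (t * g) ∂χ ≤
      Real.exp E * ∫ t, Real.exp (t * g) ∂χ := by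
    calc ∫ t, Real.exp (L * t ^ 2) * Real.exp (t * g) ∂χ
        ≤ ∫ t, Real.exp (R + g ^ 2 / (4 * L)) * Real.exp (ϰ * |t| ^ u) ∂χ := by
          refine integral_mono i2 (hχ.const_mul _) fun t => ?_
          simp only [← Real.exp_add]
          rw [Real.exp_le_exp]
          have := mul_sq_le_rpow hu hϰ (c := 2 * L) (by positivity) t
          linarith [hlin t]
      _ = Real.exp (R + g ^ 2 / (4 * L)) * K := by rw [integral_const_mul]
      _ ≤ Real.exp (R + g ^ 2 / (4 * L)) * (Real.exp D * χ.real univ) := by gcongr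
      _ = Real.exp E * χ.real univ := by
          rw [← mul_assoc, ← Real.exp_add, hE]
          congr 2
          ring
      _ ≤ Real.exp E * ∫ t, Real.exp (t * g) ∂χ := by
          gcongr
          exact measureReal_univ_le_integral_exp_mul hsymm hexp g i1
  have hpt : ∀ t : ℝ, L * (t ^ 2 * Real.exp (t * g)) ≤
      (E - 1) * Real.exp (t * g) + Real.exp (-E) * (Real.exp (L * t ^ 2) * Real.exp (t * g)) :=
    fun t => by
    have h1 := Real.add_one_le_exp (L * t ^ 2 - E)
    rw [sub_eq_add_neg, Real.exp_add] at h1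
    have h2 := mul_le_mul_of_nonneg_right h1 (Real.exp_nonneg (t * g))
    linarith
  have hint := integral_mono (i3.const_mul L) ((i1.const_mul (E - 1)).add (i2.const_mul _)) hpt
  simp only [Pi.add_apply] at hint
  rw [integral_add (i1.const_mul _) (i2.const_mul _), integral_const_mul, integral_const_mul,
    integral_const_mul] at hint
  have hlast : Real.exp (-E) * ∫ t, Real.exp (L * t ^ 2) * Real.exp (t * g) ∂χ ≤
      ∫ t, Real.exp (t * g) ∂χ := by
    refine (mul_le_mul_of_nonneg_left hexpint (Real.exp_nonneg _)).trans_eq ?_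
    rw [← mul_assoc, ← Real.exp_add, neg_add_cancel, Real.exp_zero, one_mul]
  have hI0 : 0 ≤ ∫ t, Real.exp (t * g) ∂χ := integral_nonneg fun t => Real.exp_nonneg _
  have hfin : L * ∫ t, t ^ 2 * Real.exp (t * g) ∂χ ≤ E * ∫ t, Real.exp (t * g) ∂χ := by linarith
  have hEL : E ≤ L * (D + 2 * (2 * L / ϰ) ^ (2 / (u - 2)) + (4 * L ^ 2)⁻¹ * g ^ 2) := by
    have hD0 : 0 ≤ D := abs_nonneg _
    have e1 : L * ((4 * L ^ 2)⁻¹ * g ^ 2) = g ^ 2 / (4 * L) := by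
      field_simp
    have e2 : D ≤ L * D := by nlinarith
    rw [mul_add, mul_add, e1, hE, hR]
    linarith
  refine le_of_mul_le_mul_left (hfin.trans ?_) hL0
  rw [← mul_assoc]
  exact mul_le_mul_of_nonneg_right hEL hI0

theorem lintegral_sq_mul_exp_le {χ : Measure ℝ} [IsFiniteMeasure χ] [NeZero χ]
    (hsymm : χ.map (fun t => -t) = χ) {u ϰ : ℝ} (hu : 2 < u) (hϰ : 0 < ϰ)
    (hχ : Integrable (fun t => Real.exp (ϰ * |t| ^ u)) χ) {L : ℝ} (hL : 1 ≤ L) (g : ℝ) :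
    ∫⁻ t, ENNReal.ofReal (Real.exp (t * g)) * ENNReal.ofReal (t ^ 2) ∂χ ≤
      ∫⁻ t, ENNReal.ofReal (Real.exp (t * g)) * ENNReal.ofReal
        (momentConstant χ ϰ u + 2 * (2 * L / ϰ) ^ (2 / (u - 2)) + (4 * L ^ 2)⁻¹ * g ^ 2) ∂χ := by
  obtain ⟨i1, i2, h⟩ := integral_sq_mul_exp_le hsymm hu hϰ hχ hL g
  rw [lintegral_mul_const _ (by fun_prop), mul_comm,
    ← ofReal_integral_eq_lintegral_ofReal i1 (ae_of_all _ fun t => Real.exp_nonneg _),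
    ← ENNReal.ofReal_mul' (integral_nonneg fun t => Real.exp_nonneg _)]
  refine le_trans (le_of_eq ?_) (ENNReal.ofReal_le_ofReal h)
  rw [ofReal_integral_eq_lintegral_ofReal i2 (ae_of_all _ fun t => by positivity)]
  refine lintegral_congr fun t => ?_
  rw [mul_comm, ← ENNReal.ofReal_mul (sq_nonneg t)]

theorem lintegral_pi_le_of_update {V : Type*} [Fintype V] [DecidableEq V] {χ : Measure ℝ}
    [SigmaFinite χ] {F G : (V → ℝ) → ℝ≥0∞} (hF : Measurable F) (hG : Measurable G) (x : V)
    (h : ∀ s, ∫⁻ t, F (Function.update s x t) ∂χ ≤ ∫⁻ t, G (Function.update s x t) ∂χ) :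
    ∫⁻ s, F s ∂(Measure.pi fun _ : V => χ) ≤ ∫⁻ s, G s ∂(Measure.pi fun _ : V => χ) := by
  rw [lintegral_eq_lmarginal_univ (0 : V → ℝ), lintegral_eq_lmarginal_univ (0 : V → ℝ),
    lmarginal_erase' F hF (Finset.mem_univ x), lmarginal_erase' G hG (Finset.mem_univ x)]
  exact lmarginal_mono (fun s => h s) 0

/-- The field acting on the spin at `x`. -/
def siteField {V : Type*} [Fintype V] (J : V → V → ℝ) (h : V → ℝ) (x : V) (s : V → ℝ) : ℝ :=
  2 * ∑ y, J x y * s y + h x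

theorem siteField_update {V : Type*} [Fintype V] [DecidableEq V] {J : V → V → ℝ} (h : V → ℝ)
    {x : V} (hJ : J x x = 0) (s : V → ℝ) (t : ℝ) :
    siteField J h x (Function.update s x t) = siteField J h x s := by
  unfold siteField
  congr 2
  refine Finset.sum_congr rfl fun y _ => ?_
  rcases eq_or_ne y x with rfl | hy
  · simp [hJ]
  · rw [Function.update_of_ne hy]

theorem pairForm_update {V : Type*} [Fintype V] [DecidableEq V] {J : V → V → ℝ}
    (hsymm : ∀ x y, J x y = J y x) (h : V → ℝ) {x : V} (hJ : J x x = 0) (s : V → ℝ) (t : ℝ) :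
    pairForm J h (Function.update s x t) =
      pairForm J h (Function.update s x 0) + t * siteField J h x s := by
  rw [← siteField_update h hJ s 0]
  set s₀ := Function.update s x 0
  have hs : Function.update s x t = fun y => s₀ y + if y = x then t else 0 := by
    ext y
    rcases eq_or_ne y x with rfl | hy
    · simp [s₀]
    · simp [s₀, hy]
  rw [hs]
  have e : ∀ y z, J y z * ((s₀ y + if y = x then t else 0) * (s₀ z + if z = x then t else 0)) =
      J y z * (s₀ y * s₀ z) + (if z = x then J y z * s₀ y * t else 0) +
      (if y = x then J y z * s₀ z * t else 0) +
      if y = x then (if z = x then J y z * t * t else 0) else 0 := fun y z => by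
    split_ifs <;> ring
  have e' : ∀ y, h y * (s₀ y + if y = x then t else 0) =
      h y * s₀ y + if y = x then h y * t else 0 := fun y => by
    split_ifs <;> ring
  have e3 : ∀ y, (∑ z, if y = x then J y z * s₀ z * t else 0) =
      if y = x then ∑ z, J y z * s₀ z * t else 0 := fun y => by
    split_ifs <;> simp
  have e4 : ∀ y, (∑ z, if y = x then (if z = x then J y z * t * t else 0) else 0) =
      if y = x then J y x * t * t else 0 := fun y => by
    split_ifs <;> simp
  simp only [pairForm, siteField, e, e', Finset.sum_add_distrib, Finset.sum_ite_eq',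
    Finset.mem_univ, if_true, e3, e4, hJ, zero_mul]
  have e5 : ∑ y, J y x * s₀ y * t = t * ∑ y, J x y * s₀ y := by
    rw [Finset.mul_sum]
    exact Finset.sum_congr rfl fun y _ => by rw [hsymm y x]; ring
  have e6 : ∑ y, J x y * s₀ y * t = t * ∑ y, J x y * s₀ y := by
    rw [Finset.mul_sum]
    exact Finset.sum_congr rfl fun y _ => by ring
  rw [e5, e6]
  ring

theorem measurable_siteField {V : Type*} [Fintype V] (J : V → V → ℝ) (h : V → ℝ) (x : V) :
    Measurable (siteField J h x) := by
  unfold siteField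
  fun_prop

/-- A bound on the second moment of a spin, uniform in the volume. -/
theorem lintegral_exp_pairForm_mul_sq_le {χ : Measure ℝ} [IsFiniteMeasure χ] [NeZero χ]
    (hχs : χ.map (fun t => -t) = χ) {u ϰ : ℝ} (hu : 2 < u) (hϰ : 0 < ϰ)
    (hχ : Integrable (fun t => Real.exp (ϰ * |t| ^ u)) χ) {L : ℝ} (hL : 1 ≤ L)
    {V : Type*} [Fintype V] {J : V → V → ℝ} (hsymm : ∀ x y, J x y = J y x) (h : V → ℝ) {x : V}
    (hJ : J x x = 0) :
    ∫⁻ s, ENNReal.ofReal (Real.exp (pairForm J h s)) * ENNReal.ofReal (s x ^ 2)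
      ∂(Measure.pi fun _ : V => χ) ≤
    ∫⁻ s, ENNReal.ofReal (Real.exp (pairForm J h s)) * ENNReal.ofReal
      (momentConstant χ ϰ u + 2 * (2 * L / ϰ) ^ (2 / (u - 2)) +
        (4 * L ^ 2)⁻¹ * siteField J h x s ^ 2) ∂(Measure.pi fun _ : V => χ) := by
  classical
  have m1 := measurable_pairForm J h
  have m2 := measurable_siteField J h x
  refine lintegral_pi_le_of_update (by fun_prop) (by fun_prop) x fun s => ?_
  obtain ⟨A, hA⟩ : ∃ A, ∀ t, pairForm J h (Function.update s x t) = A + t * siteField J h x s :=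
    ⟨_, pairForm_update hsymm h hJ s⟩
  simp only [siteField_update h hJ, Function.update_self, hA,
    Real.exp_add, ENNReal.ofReal_mul (Real.exp_nonneg _), mul_assoc]
  rw [lintegral_const_mul _ (by fun_prop), lintegral_const_mul _ (by fun_prop)]
  exact mul_le_mul_right (lintegral_sq_mul_exp_le hχs hu hϰ hχ hL _) _

end SiteMoment

section Summation

/-- A weighted `ℓ¹` bound for sub-solutions of a linear recursion on a locally finite graph. -/
theorem tsum_weight_le {ι : Type*} (G : SimpleGraph ι) (w b c m : ι → ℝ≥0∞)
    (hrec : ∀ x, m x ≤ c x + b x * ∑' y : G.neighborSet x, m y)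
    (hfinite : ∀ x, (G.neighborSet x).Finite)
    (hb : ∀ x y, G.Adj x y → ((G.neighborSet y).ncard : ℝ≥0∞) * (w x * b x) ≤ w y / 2)
    (hS : ∑' x, w x * m x ≠ ∞) :
    ∑' x, w x * m x ≤ 2 * ∑' x, w x * c x := by
  classical
  have hind : ∀ (x : ι) (f : ι → ℝ≥0∞), ∑' y : G.neighborSet x, f y =
      ∑' y, if G.Adj x y then f y else 0 := fun x f => by
    rw [tsum_subtype]
    rfl
  have hcol : ∀ y, ∑' x : G.neighborSet y, w x * b x ≤ w y / 2 := fun y => by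
    have hn : ∀ x : G.neighborSet y,
        w x * b x ≤ (w y / 2) / ((G.neighborSet y).ncard : ℝ≥0∞) := fun x => by
      have h0 : (G.neighborSet y).ncard ≠ 0 := by
        rw [Ne, ncard_eq_zero (hfinite y)]
        exact (nonempty_of_mem x.2).ne_empty
      rw [ENNReal.le_div_iff_mul_le (Or.inl (by exact_mod_cast h0))
        (Or.inl (ENNReal.natCast_ne_top _)), mul_comm]
      exact hb x y (G.adj_symm x.2)
    refine (ENNReal.tsum_le_tsum hn).trans ?_
    rw [ENNReal.tsum_const, ENat.card_coe_set_eq, ← (hfinite y).cast_ncard_eq]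
    exact ENNReal.mul_div_le
  have hmain : ∑' x, w x * m x ≤ ∑' x, w x * c x + (∑' x, w x * m x) / 2 := by
    calc ∑' x, w x * m x
        ≤ ∑' x, (w x * c x + ∑' y, if G.Adj x y then w x * b x * m y else 0) := by
          refine ENNReal.tsum_le_tsum fun x => ?_
          refine (mul_le_mul_right (hrec x) (w x)).trans (le_of_eq ?_)
          rw [mul_add, ← mul_assoc, hind, ← ENNReal.tsum_mul_left]
          simp only [mul_ite, mul_zero]
      _ = ∑' x, w x * c x + ∑' y, m y * ∑' x : G.neighborSet y, w x * b x := by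
          rw [ENNReal.tsum_add, ENNReal.tsum_comm]
          congr 1
          refine tsum_congr fun y => ?_
          rw [hind y fun x => w x * b x, ← ENNReal.tsum_mul_left]
          refine tsum_congr fun x => ?_
          simp only [G.adj_comm x y, mul_ite, mul_zero]
          split_ifs
          · rw [mul_comm]
          · rfl
      _ ≤ ∑' x, w x * c x + ∑' y, m y * (w y / 2) := by
          gcongr with y
          exact hcol y
      _ = ∑' x, w x * c x + (∑' x, w x * m x) / 2 := by
          rw [div_eq_mul_inv, ← ENNReal.tsum_mul_right]
          congr 1
          refine tsum_congr fun y => ?_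
          rw [div_eq_mul_inv]
          ring
  set S := ∑' x, w x * m x
  have h2 : S / 2 ≤ ∑' x, w x * c x := by
    have hh : S / 2 + S / 2 ≤ ∑' x, w x * c x + S / 2 := by rwa [ENNReal.add_halves]
    exact (ENNReal.add_le_add_iff_right (ENNReal.div_ne_top hS two_ne_zero)).1 hh
  calc S = 2 * (S / 2) := (ENNReal.mul_div_cancel two_ne_zero ENNReal.ofNat_ne_top).symm
    _ ≤ 2 * ∑' x, w x * c x := by gcongr

end Summation

section Moments

variable {d : ℕ} {γ : Set (EuclideanSpace ℝ (Fin d))} {φ : ℝ≥0 → ℝ≥0} {r : ℝ≥0}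

theorem finite_neighborSet (hγ : γ ∈ configurations d) (r : ℝ≥0) (x : γ) :
    ((gilbertGraph γ r).neighborSet x).Finite :=
  (finite_nndist_le hγ r x).subset fun _ hy => hy.2

theorem siteField_eq_tsum (hγ : γ ∈ configurations d) (hφzero : ∀ t, r < t → φ t = 0) (β : ℝ)
    (V : Finset γ) (s : V → ℝ) (σ' : γ → ℝ) (x : V) :
    siteField (coupling φ β V) (boundaryField φ β V σ') x s =
      β * ∑' y : (gilbertGraph γ r).neighborSet x,
        (φ (nndist x.1 y.1) : ℝ) * glue V s σ' y.1 := by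
  classical
  set f : γ → ℝ := ((gilbertGraph γ r).neighborSet x).indicator fun y =>
    (φ (nndist x.1 y) : ℝ) * glue V s σ' y with hf
  have hfval : ∀ y : γ, y ≠ x → f y = (φ (nndist x.1 y) : ℝ) * glue V s σ' y := fun y hy => by
    rw [hf, indicator_apply]
    split_ifs with h
    · rfl
    · have : r < nndist x.1 y := not_le.1 fun h' => h ⟨hy.symm, h'⟩
      simp [hφzero _ this]
  have hfx : f x = 0 := by
    rw [hf, indicator_of_notMem]
    exact fun h => h.1 rfl
  have hsum : Summable f := summable_of_hasFiniteSupport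
    ((finite_neighborSet hγ r x).subset support_indicator_subset)
  rw [tsum_subtype ((gilbertGraph γ r).neighborSet x.1) fun y =>
      (φ (nndist x.1 y) : ℝ) * glue V s σ' y, ← hf, ← hsum.sum_add_tsum_subtype_compl V, siteField, boundaryField, mul_add,
    Finset.mul_sum, Finset.mul_sum, ← Finset.sum_coe_sort V]
  congr 1
  · refine Finset.sum_congr rfl fun y _ => ?_
    rcases eq_or_ne x y with rfl | hxy
    · simp [coupling, hfx]
    · rw [hfval y fun h => hxy (Subtype.ext h.symm), glue_coe, coupling, if_neg hxy]
      ring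
  · refine congrArg (β * ·) (tsum_congr fun y => ?_)
    rw [hfval y.1 fun h => y.2 (h ▸ x.2), glue_of_not_mem _ _ y.2]

theorem sq_tsum_interaction_le (hγ : γ ∈ configurations d) {C : ℝ≥0} (hC : ∀ t, φ t ≤ C) (x : γ)
    (σ : γ → ℝ) :
    ENNReal.ofReal ((∑' y : (gilbertGraph γ r).neighborSet x,
        (φ (nndist x y.1) : ℝ) * σ y.1) ^ 2) ≤
      ENNReal.ofReal (C ^ 2 * numNeighbors γ r x) *
        ∑' y : (gilbertGraph γ r).neighborSet x, ENNReal.ofReal (σ y.1 ^ 2) := by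
  have := (finite_neighborSet hγ r x).fintype
  rw [tsum_fintype, tsum_fintype, ← ENNReal.ofReal_sum_of_nonneg
      (f := fun y : (gilbertGraph γ r).neighborSet x => σ y.1 ^ 2) (fun _ _ => sq_nonneg _),
    ← ENNReal.ofReal_mul (by positivity)]
  refine ENNReal.ofReal_le_ofReal ((sq_sum_le_card_mul_sum_sq (s := Finset.univ)
    (f := fun y : (gilbertGraph γ r).neighborSet x => (φ (nndist x y.1) : ℝ) * σ y.1)).trans ?_)
  have hcard : ((Finset.univ : Finset ((gilbertGraph γ r).neighborSet x)).card : ℝ) =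
      numNeighbors γ r x := by
    rw [numNeighbors, ← Nat.card_coe_set_eq, Nat.card_eq_fintype_card, Finset.card_univ]
  rw [hcard, mul_comm ((C : ℝ) ^ 2), mul_assoc]
  refine mul_le_mul_of_nonneg_left ?_ (Nat.cast_nonneg _)
  rw [Finset.mul_sum]
  refine Finset.sum_le_sum fun y _ => ?_
  rw [mul_pow]
  gcongr
  exact_mod_cast hC _

/-- The second moment of the spin at `x`. -/
noncomputable def secondMoment (P : Measure (γ → ℝ)) (x : γ) : ℝ≥0∞ :=
  ∫⁻ σ, ENNReal.ofReal (σ x ^ 2) ∂P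

variable {χ : Measure ℝ} [IsFiniteMeasure χ] [NeZero χ]

theorem coupling_symm (β : ℝ) (V : Finset γ) (x y : V) :
    coupling φ β V x y = coupling φ β V y x := by
  unfold coupling
  rw [nndist_comm]
  simp only [eq_comm]

theorem coupling_self (β : ℝ) (V : Finset γ) (x : V) : coupling φ β V x x = 0 := by
  simp [coupling]

theorem secondMoment_of_not_mem (hγ : γ ∈ configurations d)
    (hexp : ∀ c : ℝ, Integrable (fun t => Real.exp (c * t ^ 2)) χ)
    {Λ : Set (EuclideanSpace ℝ (Fin d))} (hΛ : Bornology.IsBounded Λ) (β a : ℝ) {x : γ}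
    (hx : (x : EuclideanSpace ℝ (Fin d)) ∉ Λ) :
    secondMoment (gibbsKernel γ χ φ β Λ fun _ => a) x = ENNReal.ofReal (a ^ 2) := by
  have hxV : x ∉ verticesIn γ Λ := fun h => hx ((mem_verticesIn hγ hΛ).1 h)
  have hP := isProbabilityMeasure_gibbsKernel hexp φ β Λ fun _ : γ => a
  have h1 := hP.measure_univ
  have h := lintegral_gibbsKernel (χ := χ) (Λ := Λ) φ β (fun _ : γ => a)
    (g := fun _ => ENNReal.ofReal (a ^ 2)) measurable_const
  rw [lintegral_const, h1, mul_one] at h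
  rw [secondMoment, lintegral_gibbsKernel φ β _ (g := fun σ => ENNReal.ofReal (σ x ^ 2))
    (by fun_prop)]
  simp only [glue_of_not_mem _ _ hxV]
  exact h.symm

theorem secondMoment_lt_top
    (hexp : ∀ c : ℝ, Integrable (fun t => Real.exp (c * t ^ 2)) χ)
    {Λ : Set (EuclideanSpace ℝ (Fin d))} (β a : ℝ) {x : γ} (hx : x ∈ verticesIn γ Λ) :
    secondMoment (gibbsKernel γ χ φ β Λ fun _ => a) x < ∞ := by
  rw [secondMoment, lintegral_gibbsKernel φ β _ (g := fun σ => ENNReal.ofReal (σ x ^ 2))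
    (by fun_prop)]
  simp only [glue_of_mem _ _ hx]
  refine ENNReal.mul_lt_top ?_ ?_
  · rw [boltzmann_univ hexp, ENNReal.inv_lt_top, ENNReal.ofReal_pos]
    exact partition_pos hexp φ β _ _
  · have h := (integrable_sq_mul_exp_pairForm hexp (coupling φ β (verticesIn γ Λ))
      (boundaryField φ β (verticesIn γ Λ) fun _ => a) ⟨x, hx⟩).lintegral_lt_top
    refine lt_of_le_of_lt (lintegral_mono fun s => ?_) h
    rw [ENNReal.ofReal_mul (sq_nonneg _), mul_comm]
    exact le_rfl

theorem secondMoment_le (hγ : γ ∈ configurations d) (hφzero : ∀ t, r < t → φ t = 0)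
    {C : ℝ≥0} (hC : ∀ t, φ t ≤ C) (hχs : χ.map (fun t => -t) = χ) {u ϰ : ℝ} (hu : 2 < u)
    (hϰ : 0 < ϰ) (hχ : Integrable (fun t => Real.exp (ϰ * |t| ^ u)) χ) {L : ℝ} (hL : 1 ≤ L)
    {Λ : Set (EuclideanSpace ℝ (Fin d))} (hΛ : Bornology.IsBounded Λ) (β a : ℝ) (x : γ) :
    secondMoment (gibbsKernel γ χ φ β Λ fun _ => a) x ≤
      ENNReal.ofReal (momentConstant χ ϰ u + 2 * (2 * L / ϰ) ^ (2 / (u - 2)) + a ^ 2) +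
      ENNReal.ofReal ((4 * L ^ 2)⁻¹ * (β ^ 2 * (C ^ 2 * numNeighbors γ r x))) *
        ∑' y : (gilbertGraph γ r).neighborSet x,
          secondMoment (gibbsKernel γ χ φ β Λ fun _ => a) y := by
  have hexp := integrable_exp_sq hu hϰ hχ
  have hP := isProbabilityMeasure_gibbsKernel hexp φ β Λ fun _ : γ => a
  have hD : 0 ≤ momentConstant χ ϰ u + 2 * (2 * L / ϰ) ^ (2 / (u - 2)) := by
    have : 0 ≤ momentConstant χ ϰ u := abs_nonneg _
    positivity
  by_cases hx : (x : EuclideanSpace ℝ (Fin d)) ∈ Λ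
  swap
  · rw [secondMoment_of_not_mem hγ hexp hΛ β a hx]
    refine le_trans (ENNReal.ofReal_le_ofReal ?_) le_self_add
    linarith
  have hxV : x ∈ verticesIn γ Λ := (mem_verticesIn hγ hΛ).2 hx
  have : Countable γ := (countable_of_mem_configurations hγ).to_subtype
  have hmT : Measurable fun σ : γ → ℝ => ∑' y : (gilbertGraph γ r).neighborSet x,
      (φ (nndist x y.1) : ℝ) * σ y.1 := by
    have := (finite_neighborSet hγ r x).fintype
    simp only [tsum_fintype]
    fun_prop
  set g : (γ → ℝ) → ℝ := fun σ => β * ∑' y : (gilbertGraph γ r).neighborSet x,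
      (φ (nndist x y.1) : ℝ) * σ y.1 with hg
  set D := momentConstant χ ϰ u + 2 * (2 * L / ϰ) ^ (2 / (u - 2))
  have h1 : secondMoment (gibbsKernel γ χ φ β Λ fun _ => a) x ≤
      ∫⁻ σ, ENNReal.ofReal (D + (4 * L ^ 2)⁻¹ * g σ ^ 2)
        ∂(gibbsKernel γ χ φ β Λ fun _ => a) := by
    rw [secondMoment, lintegral_gibbsKernel φ β _ (g := fun σ => ENNReal.ofReal (σ x ^ 2))
      (by fun_prop), lintegral_gibbsKernel φ β _
      (g := fun σ => ENNReal.ofReal (D + (4 * L ^ 2)⁻¹ * g σ ^ 2)) (by fun_prop)]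
    refine mul_le_mul_right ?_ _
    have key := lintegral_exp_pairForm_mul_sq_le hχs hu hϰ hχ hL
      (fun x y => coupling_symm (φ := φ) β (verticesIn γ Λ) x y)
      (boundaryField φ β (verticesIn γ Λ) fun _ => a) (coupling_self (φ := φ) β _ ⟨x, hxV⟩)
    simp only [siteField_eq_tsum hγ hφzero] at key
    simp only [glue_of_mem _ _ hxV]
    exact key
  refine h1.trans ?_
  have h2 : ∀ σ : γ → ℝ, ENNReal.ofReal (D + (4 * L ^ 2)⁻¹ * g σ ^ 2) ≤ ENNReal.ofReal D +
      ENNReal.ofReal ((4 * L ^ 2)⁻¹ * (β ^ 2 * (C ^ 2 * numNeighbors γ r x))) *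
        ∑' y : (gilbertGraph γ r).neighborSet x, ENNReal.ofReal (σ y.1 ^ 2) := fun σ => by
    rw [ENNReal.ofReal_add hD (by positivity), ENNReal.ofReal_mul (by positivity), hg, mul_pow,
      ENNReal.ofReal_mul (sq_nonneg β), ENNReal.ofReal_mul (by positivity),
      ENNReal.ofReal_mul (sq_nonneg β), mul_assoc, mul_assoc]
    gcongr
    exact sq_tsum_interaction_le hγ hC x σ
  refine (lintegral_mono h2).trans ?_
  rw [lintegral_add_left measurable_const, lintegral_const, measure_univ, mul_one,
    lintegral_const_mul _ (by fun_prop), lintegral_tsum fun y =>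
      (Measurable.ennreal_ofReal (by fun_prop)).aemeasurable]
  refine add_le_add (ENNReal.ofReal_le_ofReal ?_) le_rfl
  linarith [sq_nonneg a]

theorem weight_le_exp_mul_weight {α : ℝ} (hα : 0 ≤ α) {x y : EuclideanSpace ℝ (Fin d)} {R : ℝ}
    (h : dist x y ≤ R) : weight α x ≤ Real.exp (α * R) * weight α y := by
  unfold weight
  rw [← Real.exp_add, Real.exp_le_exp]
  have h1 : ‖y‖ ≤ ‖x‖ + R := by
    have := norm_le_norm_add_norm_sub' y x
    rw [dist_comm, dist_eq_norm] at h
    linarith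
  nlinarith

theorem weight_pos (α : ℝ) (x : EuclideanSpace ℝ (Fin d)) : 0 < weight α x := Real.exp_pos _

/-- One plus the sum of `(n(x) n(y)) ^ θ` over the neighbours `y` of `x`. -/
noncomputable def degreeSum (γ : Set (EuclideanSpace ℝ (Fin d))) (r θ : ℝ) (x : γ) : ℝ :=
  1 + ∑' y : (gilbertGraph γ r).neighborSet x,
    ((numNeighbors γ r x : ℝ) * (numNeighbors γ r y.1 : ℝ)) ^ θ

theorem one_le_degreeSum (r θ : ℝ) (x : γ) : 1 ≤ degreeSum γ r θ x :=
  le_add_of_nonneg_right (tsum_nonneg fun _ => by positivity)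

theorem le_degreeSum_rpow_inv (hγ : γ ∈ configurations d) {θ : ℝ} (hθ : 0 < θ) {x y : γ}
    (h : (gilbertGraph γ r).Adj x y) :
    (numNeighbors γ r x : ℝ) * numNeighbors γ r y ≤ degreeSum γ r θ x ^ θ⁻¹ := by
  have := (finite_neighborSet hγ r x).fintype
  have h0 : 0 ≤ degreeSum γ r θ x := zero_le_one.trans (one_le_degreeSum _ _ _)
  have h1 : 0 ≤ (numNeighbors γ r x : ℝ) * numNeighbors γ r y := by positivity
  refine (Real.le_rpow_inv_iff_of_pos h1 h0 hθ).2 ?_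
  rw [degreeSum, tsum_fintype]
  refine le_add_of_nonneg_of_le zero_le_one ?_
  have hmem : (⟨y, h⟩ : (gilbertGraph γ r).neighborSet x) ∈ Finset.univ := Finset.mem_univ _
  have key := Finset.single_le_sum (N := ℝ) (f := fun z : (gilbertGraph γ r).neighborSet x =>
    ((numNeighbors γ r x : ℝ) * (numNeighbors γ r z.1 : ℝ)) ^ θ)
    (fun z _ => Real.rpow_nonneg (mul_nonneg (Nat.cast_nonneg _) (Nat.cast_nonneg _)) θ) hmem
  exact key

theorem tsum_weight_mul_degreeSum (hγ : γ ∈ configurations d) (α θ : ℝ) :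
    ∑' x : γ, ENNReal.ofReal (weight α (x : EuclideanSpace ℝ (Fin d)) * degreeSum γ r θ x) =
      vertexSum γ α + edgeSum γ r α θ := by
  rw [vertexSum, edgeSum, ← ENNReal.tsum_add]
  refine tsum_congr fun x => ?_
  have := (finite_neighborSet hγ r x).fintype
  have hw := (weight_pos α (x : EuclideanSpace ℝ (Fin d))).le
  rw [degreeSum, tsum_fintype, tsum_fintype, mul_add, mul_one, Finset.mul_sum,
    ENNReal.ofReal_add hw (Finset.sum_nonneg fun _ _ => by positivity),
    ENNReal.ofReal_sum_of_nonneg fun _ _ => by positivity]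

theorem numNeighbors_pos (hγ : γ ∈ configurations d) {x y : γ}
    (h : (gilbertGraph γ r).Adj x y) : 1 ≤ numNeighbors γ r x := by
  rw [Nat.one_le_iff_ne_zero, numNeighbors, Ne, ncard_eq_zero (finite_neighborSet hγ r x)]
  exact (nonempty_of_mem (show y ∈ (gilbertGraph γ r).neighborSet x from h)).ne_empty

/-- The second moments in a finite volume are bounded uniformly in the volume. -/
theorem exists_secondMoment_le (hγ : γ ∈ sparseConfigurations d r)
    (hφzero : ∀ t, r < t → φ t = 0)
    {C : ℝ≥0} (hC : ∀ t, φ t ≤ C) (hχs : χ.map (fun t => -t) = χ) {u ϰ : ℝ} (hu : 2 < u)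
    (hϰ : 0 < ϰ) (hχ : Integrable (fun t => Real.exp (ϰ * |t| ^ u)) χ) (β a : ℝ) (x : γ) :
    ∃ K : ℝ≥0∞, K < ∞ ∧ ∀ Λ : Set (EuclideanSpace ℝ (Fin d)), Bornology.IsBounded Λ →
      secondMoment (gibbsKernel γ χ φ β Λ fun _ => a) x ≤ K := by
  obtain ⟨hγ, hedge, hvertex⟩ := hγ
  have hexp := integrable_exp_sq hu hϰ hχ
  set p := 2 / (u - 2) with hp
  have hp0 : 0 < p := div_pos two_pos (by linarith)
  set A := |β| * C * Real.exp r with hA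
  have hA0 : 0 ≤ A := by positivity
  set L : γ → ℝ := fun x => (1 + A) * degreeSum γ r p x ^ p⁻¹ with hL
  have hQ1 : ∀ x : γ, 1 ≤ degreeSum γ r p x ^ p⁻¹ := fun x =>
    Real.one_le_rpow (one_le_degreeSum _ _ _) (by positivity)
  have hL1 : ∀ x, 1 ≤ L x := fun x => by
    have := hQ1 x
    rw [hL]
    nlinarith
  set w : γ → ℝ≥0∞ := fun x => ENNReal.ofReal (weight 1 (x : EuclideanSpace ℝ (Fin d))) with hw
  have hwpos : ∀ x, w x ≠ 0 := fun x => (ENNReal.ofReal_pos.2 (weight_pos _ _)).ne'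
  set c : γ → ℝ≥0∞ := fun x =>
    ENNReal.ofReal (momentConstant χ ϰ u + 2 * (2 * L x / ϰ) ^ p + a ^ 2) with hc
  set b : γ → ℝ≥0∞ := fun x =>
    ENNReal.ofReal ((4 * L x ^ 2)⁻¹ * (β ^ 2 * (C ^ 2 * numNeighbors γ r x))) with hb
  have hvs : ∑' x, w x < ∞ := hvertex 1 one_pos
  have hT : ∑' x, w x * c x < ∞ := by
    set c₁ := momentConstant χ ϰ u + a ^ 2 with hc₁
    set c₂ := 2 * (2 * (1 + A) / ϰ) ^ p with hc₂
    have hc₁0 : 0 ≤ c₁ := add_nonneg (abs_nonneg _) (sq_nonneg a)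
    have hc₂0 : 0 ≤ c₂ := by positivity
    have hcx : ∀ x, w x * c x ≤ ENNReal.ofReal (c₁ + c₂) *
        ENNReal.ofReal (weight 1 (x : EuclideanSpace ℝ (Fin d)) * degreeSum γ r p x) := fun x => by
      have hQ := one_le_degreeSum (γ := γ) r p x
      have hLp : 2 * (2 * L x / ϰ) ^ p = c₂ * degreeSum γ r p x := by
        rw [hc₂, hL, show 2 * ((1 + A) * degreeSum γ r p x ^ p⁻¹) / ϰ =
          (2 * (1 + A) / ϰ) * degreeSum γ r p x ^ p⁻¹ by ring,
          Real.mul_rpow (by positivity) (by linarith [hQ1 x]), Real.rpow_inv_rpow (by linarith)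
          hp0.ne']
        ring
      rw [hw, hc, ← ENNReal.ofReal_mul (weight_pos _ _).le, ← ENNReal.ofReal_mul (by positivity)]
      refine ENNReal.ofReal_le_ofReal ?_
      rw [hLp, mul_left_comm]
      refine mul_le_mul_of_nonneg_left ?_ (weight_pos _ _).le
      nlinarith
    refine (ENNReal.tsum_le_tsum hcx).trans_lt ?_
    rw [ENNReal.tsum_mul_left, tsum_weight_mul_degreeSum hγ]
    exact ENNReal.mul_lt_top ENNReal.ofReal_lt_top
      (ENNReal.add_lt_top.2 ⟨hvertex 1 one_pos, hedge 1 one_pos p hp0⟩)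
  have hbw : ∀ x y, (gilbertGraph γ r).Adj x y →
      (((gilbertGraph γ r).neighborSet y).ncard : ℝ≥0∞) * (w x * b x) ≤ w y / 2 := by
    intro x y hxy
    have hnx := numNeighbors_pos hγ hxy
    have hny := numNeighbors_pos hγ hxy.symm
    have hnx' : (1 : ℝ) ≤ numNeighbors γ r x := by exact_mod_cast hnx
    have hny' : (1 : ℝ) ≤ numNeighbors γ r y := by exact_mod_cast hny
    have hLn : A * (numNeighbors γ r x * numNeighbors γ r y) ≤ L x := by
      have h1 := le_degreeSum_rpow_inv hγ hp0 hxy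
      have h2 := hQ1 x
      rw [hL]
      nlinarith
    have hLpos : 0 < L x := by linarith [hL1 x]
    have hwle : weight 1 (x : EuclideanSpace ℝ (Fin d)) ≤
        Real.exp r * weight 1 (y : EuclideanSpace ℝ (Fin d)) := by
      simpa using weight_le_exp_mul_weight (α := 1) zero_le_one
        (show dist (x : EuclideanSpace ℝ (Fin d)) y ≤ r from hxy.2)
    have hwy := weight_pos 1 (y : EuclideanSpace ℝ (Fin d))
    change ((numNeighbors γ r y : ℕ) : ℝ≥0∞) * _ ≤ _
    rw [hw, hb, ← ENNReal.ofReal_natCast, ← ENNReal.ofReal_mul (weight_pos _ _).le,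
      ← ENNReal.ofReal_mul (Nat.cast_nonneg _), ← ENNReal.ofReal_ofNat 2,
      ← ENNReal.ofReal_div_of_pos two_pos]
    refine ENNReal.ofReal_le_ofReal ?_
    set N : ℝ := numNeighbors γ r x * numNeighbors γ r y with hN
    have hN1 : 1 ≤ N := one_le_mul_of_one_le_of_one_le hnx' hny'
    have hLsq : β ^ 2 * C ^ 2 * Real.exp r * N ≤ L x ^ 2 := by
      calc β ^ 2 * C ^ 2 * Real.exp r * N
          ≤ β ^ 2 * C ^ 2 * Real.exp r ^ 2 * N ^ 2 := by
            have h1 : (1 : ℝ) ≤ Real.exp r := Real.one_le_exp r.2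
            gcongr
            · exact le_self_pow₀ h1 two_ne_zero
            · exact le_self_pow₀ hN1 two_ne_zero
        _ = (A * N) ^ 2 := by
            rw [hA, ← sq_abs β]
            ring
        _ ≤ L x ^ 2 := pow_le_pow_left₀ (by positivity) hLn 2
    calc (numNeighbors γ r y : ℝ) * (weight 1 (x : EuclideanSpace ℝ (Fin d)) *
          ((4 * L x ^ 2)⁻¹ * (β ^ 2 * (C ^ 2 * numNeighbors γ r x))))
        = weight 1 (x : EuclideanSpace ℝ (Fin d)) * ((4 * L x ^ 2)⁻¹ * (β ^ 2 * C ^ 2 * N)) := by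
          rw [hN]
          ring
      _ ≤ Real.exp r * weight 1 (y : EuclideanSpace ℝ (Fin d)) *
          ((4 * L x ^ 2)⁻¹ * (β ^ 2 * C ^ 2 * N)) := by gcongr
      _ = weight 1 (y : EuclideanSpace ℝ (Fin d)) *
          ((β ^ 2 * C ^ 2 * Real.exp r * N) / (4 * L x ^ 2)) := by
          rw [div_eq_inv_mul]
          ring
      _ ≤ weight 1 (y : EuclideanSpace ℝ (Fin d)) * (1 / 2) := by
          refine mul_le_mul_of_nonneg_left ?_ hwy.le
          rw [div_le_iff₀ (by positivity)]
          nlinarith [sq_nonneg (L x)]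
      _ = weight 1 (y : EuclideanSpace ℝ (Fin d)) / 2 := by ring
  have hm0 : ∀ Λ : Set (EuclideanSpace ℝ (Fin d)), Bornology.IsBounded Λ →
      ∑' x, w x * secondMoment (gibbsKernel γ χ φ β Λ fun _ => a) x ≠ ∞ := by
    intro Λ hΛ
    have hle : ∀ x, w x * secondMoment (gibbsKernel γ χ φ β Λ fun _ => a) x ≤
        (verticesIn γ Λ : Set γ).indicator
          (fun x => w x * secondMoment (gibbsKernel γ χ φ β Λ fun _ => a) x) x +
          w x * ENNReal.ofReal (a ^ 2) := fun x => by
      by_cases hx : x ∈ verticesIn γ Λ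
      · rw [indicator_of_mem (Finset.mem_coe.2 hx)]
        exact le_self_add
      · rw [secondMoment_of_not_mem hγ hexp hΛ β a fun h => hx ((mem_verticesIn hγ hΛ).2 h)]
        exact le_add_self
    refine ((ENNReal.tsum_le_tsum hle).trans_lt ?_).ne
    rw [ENNReal.tsum_add, ENNReal.tsum_mul_right, ← sum_eq_tsum_indicator]
    refine ENNReal.add_lt_top.2 ⟨ENNReal.sum_lt_top.2 fun x hx => ?_,
      ENNReal.mul_lt_top hvs ENNReal.ofReal_lt_top⟩
    exact ENNReal.mul_lt_top ENNReal.ofReal_lt_top (secondMoment_lt_top hexp β a hx)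
  refine ⟨(2 * ∑' x, w x * c x) / w x, ?_, fun Λ hΛ => ?_⟩
  · exact ENNReal.div_lt_top (ENNReal.mul_lt_top ENNReal.ofNat_lt_top hT).ne (hwpos x)
  · rw [ENNReal.le_div_iff_mul_le (Or.inl (hwpos x)) (Or.inl ENNReal.ofReal_ne_top), mul_comm]
    refine (ENNReal.le_tsum x).trans (tsum_weight_le (gilbertGraph γ r) w b c
      (secondMoment (gibbsKernel γ χ φ β Λ fun _ => a)) (fun x => ?_)
      (finite_neighborSet hγ r) hbw (hm0 Λ hΛ))
    exact secondMoment_le hγ hφzero hC hχs hu hϰ hχ (hL1 x) hΛ β a x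

theorem integrable_of_sparse (hγ : γ ∈ sparseConfigurations d r)
    (hφzero : ∀ t, r < t → φ t = 0)
    {C : ℝ≥0} (hC : ∀ t, φ t ≤ C) (hχs : χ.map (fun t => -t) = χ) {u ϰ : ℝ} (hu : 2 < u)
    (hϰ : 0 < ϰ) (hχ : Integrable (fun t => Real.exp (ϰ * |t| ^ u)) χ) {β a : ℝ}
    {μ : Measure (γ → ℝ)} (hμ : IsLimitingState γ χ φ β a μ) (x : γ) :
    Integrable (fun σ : γ → ℝ => σ x) μ := by
  obtain ⟨hμG, Λ, hΛ, hlim⟩ := hμ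
  have := hμG.1
  have hm : Measurable fun σ : γ → ℝ => σ x := measurable_pi_apply x
  obtain ⟨K, hK, hKΛ⟩ := exists_secondMoment_le hγ hφzero hC hχs hu hϰ hχ β a x
  have e : ∀ R : Measure (γ → ℝ),
      ∫⁻ t, ENNReal.ofReal (t ^ 2) ∂(R.map fun σ => σ x) = secondMoment R x := fun R =>
    lintegral_map (by fun_prop) hm
  have hle := lintegral_le_liminf_lintegral_of_forall_isOpen_measure_le_liminf_measure
    (μ := μ.map fun σ => σ x)
    (μs := fun n => (gibbsKernel γ χ φ β (Λ n) fun _ => a).map fun σ => σ x)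
    (f := fun t => t ^ 2) (by fun_prop) (fun t => sq_nonneg t)
    fun G hG => (tendsto_eval_preimage hlim x hG.measurableSet).liminf_eq.ge
  simp only [e] at hle
  have hfin : secondMoment μ x < ∞ := by
    refine (hle.trans ?_).trans_lt hK
    refine liminf_le_of_le (by isBoundedDefault) fun b hb => ?_
    obtain ⟨n, hn⟩ := hb.exists
    exact hn.trans (hKΛ _ (hΛ.1 n).1)
  have hsq : Integrable (fun σ : γ → ℝ => σ x ^ 2) μ := by
    refine ⟨(hm.pow_const 2).aestronglyMeasurable, ?_⟩
    rw [hasFiniteIntegral_iff_ofReal (ae_of_all _ fun σ => sq_nonneg _)]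
    exact hfin
  refine ((integrable_const (1 : ℝ)).add hsq).mono' hm.aestronglyMeasurable
    (ae_of_all _ fun σ => ?_)
  rw [Real.norm_eq_abs, Pi.add_apply]
  nlinarith [sq_abs (σ x), sq_nonneg (|σ x| - 1)]

end Moments

end AmorphousFerromagnet

theorem proposition4 {d : ℕ} (γ : Set (EuclideanSpace ℝ (Fin d)))
    (hγ : γ ∈ AmorphousFerromagnet.configurations d)
    -- the interaction
    (φ : ℝ≥0 → ℝ≥0) (r φ₀ : ℝ≥0) (hr : 0 < r) (hφ₀ : 0 < φ₀) (hφm : Measurable φ)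
    (hφb : ∃ C : ℝ≥0, ∀ t, φ t ≤ C) (hφpos : ∀ t, t ≤ r → φ₀ ≤ φ t)
    (hφzero : ∀ t, r < t → φ t = 0)
    -- the single-spin measure
    (χ : Measure ℝ) [IsFiniteMeasure χ] (hsymm : χ.map (fun t => -t) = χ)
    (u ϰ : ℝ) (hu : 2 < u) (hϰ : 0 < ϰ) (hχ : Integrable (fun t => Real.exp (ϰ * |t| ^ u)) χ)
    (β : ℝ) (hβ : 0 < β)
    (a : ℝ) (ha : 0 < a) (hWells : χ (Icc 0 a) ≤ χ (Ici (a * √2)))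
    (μ : Measure (γ → ℝ)) (hμ : AmorphousFerromagnet.IsLimitingState γ χ φ β a μ)
    (ν : Measure (γ → ℝ)) (hν : AmorphousFerromagnet.IsIsingPlusState γ φ (a ^ 2 * β) ν)
    (x : γ) :
    Integrable (fun σ : γ → ℝ => σ x) ν ∧
    (γ ∈ AmorphousFerromagnet.sparseConfigurations d r →
      Integrable (fun σ : γ → ℝ => σ x) μ) ∧
    (Integrable (fun σ : γ → ℝ => σ x) μ → ∫ σ, σ x ∂μ ≥ a * ∫ σ, σ x ∂ν) := by
  obtain ⟨C, hC⟩ := hφb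
  have : NeZero χ := AmorphousFerromagnet.neZero_of_mem_gibbsMeasures hγ x hμ.1
  have : IsProbabilityMeasure ν := hν.1.1
  refine ⟨(AmorphousFerromagnet.integral_of_ae_ising
    (AmorphousFerromagnet.ae_isingGibbs hγ hν.1 x)).1, fun hs => ?_, fun hint => ?_⟩
  · exact AmorphousFerromagnet.integrable_of_sparse hs hφzero hC hsymm hu hϰ hχ hμ x
  · exact AmorphousFerromagnet.integral_ge_of_isLimitingState hγ hφzero hsymm
      (AmorphousFerromagnet.integrable_exp_sq hu hϰ hχ) hβ.le ha hWells hμ hν.1 hint
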